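/- Setting. Let $\Omega\subset\mathbb R^3$ be a bounded domain with Lipschitz boundary, split by an interface: $\Omega_1,\Omega_2\subset\Omega$ are disjoint, open and connected, $\Gamma_{\rm I}=\overline\Omega_1\cap\overline\Omega_2$, and $\Omega=\Omega_1\cup\Omega_2\cup(\Gamma_{\rm I}\cap\Omega)$. The boundary of $\Omega_1\cup\Omega_2$ is the union of $\Gamma_{\rm I}$ and measurable sets $\Gamma_{\rm io},\Gamma_{\rm s}$, which pairwise overlap only in sets of surface measure zero. Suppose that $\Omega_1$ and $\Omega_2$ can be triangulated exactly by finitely many tetrahedra (so they are polyhedral). Let $n$ be the unit normal on $\Gamma_{\rm I}$ pointing out of $\Omega_1$. For a function $p$ on $\Omega_1\cup\Omega_2$ let $p_i$ and $\partial p_i/\partial n$ be its trace and normal derivative on $\Gamma_{\rm I}$ taken from $\Omega_i$ (element by element for piecewise polynomials), and put $[\![p]\!]=p_1-p_2$ and $\{\partial p/\partial n\}=\frac12(\partial p_1/\partial n+\partial p_2/\partial n)$. Let $H^m(\Omega_1\cup\Omega_2)$ be the Sobolev space of complex-valued functions on the (disconnected) open set $\Omega_1\cup\Omega_2$. Let $\mathcal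 T_1,\mathcal T_2$ be tetrahedral triangulations of $\Omega_1,\Omega_2$ (not necessarily matching on $\Gamma_{\rm I}$), let $h$ be the largest diameter of their elements, let $k\ge1$, and let $V_h=V_1^h+V_2^h$, where $V_i^h$ consists of the functions in $H^1(\Omega_1\cup\Omega_2)$ that are polynomials of degree at most $k$ on each element of $\mathcal T_i$ and vanish on $\Omega\setminus\Omega_i$. For $\kappa,\gamma>0$ and $\zeta\in L^\infty(\Gamma_{\rm I};\mathbb C)$ put $\lambda=\bigl(\frac h\gamma+\frac{\zeta}{{\rm i}\kappa}\bigr)^{-1}$, $$a_0(p,q)=\int_{\Omega_1\cup\Omega_2}\nabla p\cdot\nabla q-\kappa^2\int_{\Omega_1\cup\Omega_2}pq+{\rm i}\kappa\int_{\Gamma_{\rm io}}pq,$$ $$\begin{aligned}a_\lambda(p,q)=a_0(p,q)&-\int_{\Gamma_{\rm I}}\Bigl\{\frac{\partial p}{\partial n}\Bigr\}\Bigl([\![q]\!]+\frac{\zeta}{{\rm i}\kappa}\Bigl\{\frac{\partial q}{\partial n}\Bigr\}\Bigr)-\int_{\Gamma_{\rm I}}\Bigl([\![p]\!]+\frac{\zeta}{{\rm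 i}\kappa}\Bigl\{\frac{\partial p}{\partial n}\Bigr\}\Bigr)\Bigl\{\frac{\partial q}{\partial n}\Bigr\}\\&+\int_{\Gamma_{\rm I}}\frac{\zeta}{{\rm i}\kappa}\Bigl\{\frac{\partial p}{\partial n}\Bigr\}\Bigl\{\frac{\partial q}{\partial n}\Bigr\}+\int_{\Gamma_{\rm I}}\lambda\Bigl([\![p]\!]+\frac{\zeta}{{\rm i}\kappa}\Bigl\{\frac{\partial p}{\partial n}\Bigr\}\Bigr)\Bigl([\![q]\!]+\frac{\zeta}{{\rm i}\kappa}\Bigl\{\frac{\partial q}{\partial n}\Bigr\}\Bigr),\end{aligned}$$ $$|||p|||^2=\int_{\Omega_1\cup\Omega_2}|\nabla p|^2+\kappa^2\int_{\Omega_1\cup\Omega_2}|p|^2+\frac1\gamma\int_{\Gamma_{\rm I}}h\,\Bigl|\Bigl\{\frac{\partial p}{\partial n}\Bigr\}\Bigr|^2+\int_{\Gamma_{\rm I}}|\lambda|\,\bigl|[\![p]\!]\bigr|^2 .$$ Theorem (Continuity). There is a constant $c\ge0$ in the trace inequality $\|p\|_{L^2(\partial\Omega_i)}\le c\,\|p\|_{H^1(\Omega_i)}$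 for all $p\in H^1(\Omega_i)$, $i=1,2$. There is a constant $C_c=C_c(\kappa,c)$ that depends only on $\kappa$ and on such a trace constant $c$ (in particular, not on $h$, the triangulations, $k$, $\gamma$ or $\zeta$) with the following property: if $$h\,\operatorname{Im}\zeta\ \ge\ -\frac{\gamma}{4\kappa}|\zeta|^2\qquad\text{almost everywhere on }\Gamma_{\rm I},$$ then $$|a_\lambda(p,q)|\le C_c\,|||p|||\;|||q|||\qquad\text{for all }p,q\in V_h\cup H^2(\Omega_1\cup\Omega_2).$$ -/

import Mathlib

open MeasureTheory Set Filter Topology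
open scoped ENNReal NNReal ContDiff

noncomputable section

namespace NitscheHelmholtz

/-- Three-dimensional Euclidean space. -/
abbrev E : Type := EuclideanSpace ℝ (Fin 3)

/-- Surface area: the two-dimensional Hausdorff measure, normalized so that it agrees with the
Lebesgue measure on planes. -/
abbrev surf : Measure E := Measure.euclideanHausdorffMeasure 2

/-- The `j`-th standard unit vector. -/
abbrev unitVec (j : Fin 3) : E := EuclideanSpace.single j (1 : ℝ)

/-! ### Sobolev spaces through weak derivatives -/

/-- `v` is the weak partial derivative `∂u/∂x_j` in the open set `U`. -/
def HasWeakPartial (U : Set E) (j : Fin 3) (u v : E → ℂ) : Prop :=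
  ∀ φ : E → ℝ, ContDiff ℝ ∞ φ → HasCompactSupport φ → tsupport φ ⊆ U →
    ∫ x in U, (fderiv ℝ φ x (unitVec j)) • u x = -∫ x in U, φ x • v x

/-- `u` belongs to the Sobolev space `H^m(U)`: the function `u` and all of its weak partial
derivatives up to order `m` are in `L²(U)`. -/
def MemSobolev (U : Set E) : ℕ → (E → ℂ) → Prop
  | 0, u => MemLp u 2 (volume.restrict U)
  | m + 1, u => MemLp u 2 (volume.restrict U) ∧
      ∀ j : Fin 3, ∃ v : E → ℂ, HasWeakPartial U j u v ∧ MemSobolev U m v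

open Classical in
/-- The weak partial derivative `∂u/∂x_j` in `U` (a representative of it; `0` if there is no
square integrable one). -/
def weakPartial (U : Set E) (j : Fin 3) (u : E → ℂ) : E → ℂ :=
  if h : ∃ v : E → ℂ, MemLp v 2 (volume.restrict U) ∧ HasWeakPartial U j u v then h.choose else 0

/-- The square of the `H¹(U)` norm. -/
def sobolevNormSq (U : Set E) (u : E → ℂ) : ℝ :=
  (∫ x in U, ‖u x‖ ^ 2) + ∑ j : Fin 3, ∫ x in U, ‖weakPartial U j u x‖ ^ 2

/-! ### Traces -/

/-- `g` is the trace on `S ⊆ ∂U` of the function `u ∈ H¹(U)`: the pair `(u, g)` is the limit in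
`H¹(U) × L²(S)` of pairs `(φ|_U, φ|_S)` with `φ` smooth up to the boundary. -/
def IsTrace (U S : Set E) (u g : E → ℂ) : Prop :=
  MemSobolev U 1 u ∧ MemLp g 2 (surf.restrict S) ∧
  ∃ φ : ℕ → E → ℂ, (∀ n, ContDiff ℝ ∞ (φ n)) ∧
    Tendsto (fun n => eLpNorm (fun x => φ n x - u x) 2 (volume.restrict U)) atTop (𝓝 0) ∧
    (∀ j : Fin 3, Tendsto (fun n => eLpNorm
      (fun x => fderiv ℝ (φ n) x (unitVec j) - weakPartial U j u x) 2 (volume.restrict U))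
      atTop (𝓝 0)) ∧
    Tendsto (fun n => eLpNorm (fun x => φ n x - g x) 2 (surf.restrict S)) atTop (𝓝 0)

open Classical in
/-- The trace on `∂U` of a function in `H¹(U)` (a representative of it). -/
def trace (U : Set E) (u : E → ℂ) : E → ℂ :=
  if h : ∃ g : E → ℂ, IsTrace U (frontier U) u g then h.choose else 0

/-! ### Geometry -/

/-- `U` is a bounded open set with Lipschitz boundary: near each boundary point, and in a suitable
orthonormal coordinate system, `U` is the set of points above the graph of a Lipschitz function. -/
def IsBoundedLipschitz (U : Set E) : Prop :=
  IsOpen U ∧ Bornology.IsBounded U ∧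
  ∀ x ∈ frontier U, ∃ (A : E ≃ₗᵢ[ℝ] E) (f : ℝ × ℝ → ℝ) (L : ℝ≥0) (r : ℝ),
    LipschitzWith L f ∧ 0 < r ∧
    ∀ y ∈ Metric.ball x r, y ∈ U ↔ f (A y 0, A y 1) < A y 2

/-- `ν` is the outward unit normal of `U` at the boundary point `x`. -/
def IsOuterNormal (U : Set E) (x ν : E) : Prop :=
  ‖ν‖ = 1 ∧ ∀ ε : ℝ, 0 < ε → ∀ᶠ y in 𝓝 x,
    (inner ℝ (y - x) ν < -ε * ‖y - x‖ → y ∈ U) ∧ (ε * ‖y - x‖ < inner ℝ (y - x) ν → y ∉ U)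

/-- A bounded Lipschitz domain `Ω`, split into the subdomains `Ω₁ = sub 0` and `Ω₂ = sub 1` by the
interface `Γ_I = closure Ω₁ ∩ closure Ω₂`, with the remaining part of the boundary of `Ω₁ ∪ Ω₂`
divided into `Γ_io` and `Γ_s`, and with a unit normal field on `Γ_I`, pointing out of `Ω₁`. -/
structure SplitDomain where
  Ω : Set E
  sub : Fin 2 → Set E
  Γio : Set E
  Γs : Set E
  normal : E → E
  lipschitz : IsBoundedLipschitz Ω
  connected : IsConnected Ω
  sub_open : ∀ i, IsOpen (sub i)
  sub_connected : ∀ i, IsConnected (sub i)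
  sub_disjoint : Disjoint (sub 0) (sub 1)
  split : Ω = sub 0 ∪ sub 1 ∪ (closure (sub 0) ∩ closure (sub 1) ∩ Ω)
  measurable_Γio : MeasurableSet Γio
  measurable_Γs : MeasurableSet Γs
  boundary : frontier (sub 0 ∪ sub 1) = (closure (sub 0) ∩ closure (sub 1)) ∪ Γio ∪ Γs
  null_I_io : surf (closure (sub 0) ∩ closure (sub 1) ∩ Γio) = 0
  null_I_s : surf (closure (sub 0) ∩ closure (sub 1) ∩ Γs) = 0
  null_io_s : surf (Γio ∩ Γs) = 0
  normal_measurable :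
    AEStronglyMeasurable normal (surf.restrict (closure (sub 0) ∩ closure (sub 1)))
  normal_spec : ∀ᵐ x ∂(surf.restrict (closure (sub 0) ∩ closure (sub 1))),
    IsOuterNormal (sub 0) x (normal x)

namespace SplitDomain

/-- The interface `Γ_I`. -/
def ΓI (D : SplitDomain) : Set E := closure (D.sub 0) ∩ closure (D.sub 1)

/-- The disconnected open set `Ω₁ ∪ Ω₂`. -/
def bulk (D : SplitDomain) : Set E := D.sub 0 ∪ D.sub 1

/-- `c` is an admissible constant in the trace inequality
`‖p‖_{L²(∂Ω_i)} ≤ c ‖p‖_{H¹(Ω_i)}`, `i = 1, 2`. -/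
def IsTraceConstant (D : SplitDomain) (c : ℝ) : Prop :=
  0 ≤ c ∧ ∀ (i : Fin 2) (p : E → ℂ), MemSobolev (D.sub i) 1 p →
    ∫ x in frontier (D.sub i), ‖trace (D.sub i) p x‖ ^ 2 ∂surf
      ≤ c ^ 2 * sobolevNormSq (D.sub i) p

end SplitDomain

/-! ### Meshes and finite elements -/

/-- A (face-to-face) triangulation of the open set `U` by finitely many closed tetrahedra. -/
structure Triangulation (U : Set E) where
  complex : Geometry.SimplicialComplex ℝ E
  finite : complex.faces.Finite
  pure : ∀ s ∈ complex.faces, ∃ t ∈ complex.faces, s ⊆ t ∧ t.card = 4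
  cover : complex.space = closure U
  interior_subset : ∀ s ∈ complex.faces, interior (convexHull ℝ (s : Set E)) ⊆ U

/-- The elements of a triangulation, as closed tetrahedra. -/
def Triangulation.cells {U : Set E} (T : Triangulation U) : Set (Set E) :=
  {K | ∃ s ∈ T.complex.faces, s.card = 4 ∧ K = convexHull ℝ (s : Set E)}

namespace SplitDomain

/-- A pair of triangulations of `Ω₁` and `Ω₂`, not necessarily matching on the interface. -/
structure Mesh (D : SplitDomain) where
  tri : ∀ i, Triangulation (D.sub i)

namespace Mesh

variable {D : SplitDomain}

/-- The mesh size: the largest diameter of an element. -/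
def h (T : D.Mesh) : ℝ :=
  sSup {d : ℝ | ∃ i, ∃ K ∈ (T.tri i).cells, d = Metric.diam K}

/-- The space `V_i^h`: functions in `H¹(Ω₁ ∪ Ω₂)` that are polynomials of degree at most `k` on
each element of the triangulation of `Ω_i` and vanish in the rest of `Ω`. -/
def MemVi (T : D.Mesh) (k : ℕ) (i : Fin 2) (v : E → ℂ) : Prop :=
  MemSobolev D.bulk 1 v ∧
  (∀ K ∈ (T.tri i).cells, ∃ P : MvPolynomial (Fin 3) ℂ, P.totalDegree ≤ k ∧
    v =ᵐ[volume.restrict K] fun x => MvPolynomial.eval (fun j => (x j : ℂ)) P) ∧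
  v =ᵐ[volume.restrict (D.Ω \ D.sub i)] 0

/-- The finite element space `V_h = V_1^h + V_2^h`. -/
def MemVh (T : D.Mesh) (k : ℕ) (p : E → ℂ) : Prop :=
  ∃ v₁ v₂ : E → ℂ, T.MemVi k 0 v₁ ∧ T.MemVi k 1 v₂ ∧ p = v₁ + v₂

/-- Membership in `V_h ∪ H²(Ω₁ ∪ Ω₂)`. -/
def MemVhOrH2 (T : D.Mesh) (k : ℕ) (p : E → ℂ) : Prop :=
  T.MemVh k p ∨ MemSobolev D.bulk 2 p

open Classical in
/-- The trace of `∂p/∂x_j` on `Γ_I`, taken from the side of `Ω_i` and element by element. For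
`p ∈ H²(Ω₁ ∪ Ω₂)` it is the trace of `∂p/∂x_j ∈ H¹(Ω_i)`; for `p ∈ V_h` it is, on the boundary of
each element, the classical derivative of the polynomial by which `p` is given there. -/
def gradTrace (T : D.Mesh) (i : Fin 2) (j : Fin 3) (p : E → ℂ) : E → ℂ :=
  if h : ∃ g : E → ℂ, MemLp g 2 (surf.restrict D.ΓI) ∧
      ∀ K ∈ (T.tri i).cells, IsTrace (interior K) (D.ΓI ∩ K) (weakPartial D.bulk j p) g
  then h.choose else 0

/-- The one-sided normal derivative `∂p_i/∂n` on `Γ_I`. -/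
def normalDeriv (T : D.Mesh) (i : Fin 2) (p : E → ℂ) (x : E) : ℂ :=
  ∑ j : Fin 3, ((D.normal x j : ℝ) : ℂ) * T.gradTrace i j p x

/-- The average flux `{∂p/∂n}` on `Γ_I`. -/
def avgFlux (T : D.Mesh) (p : E → ℂ) (x : E) : ℂ :=
  (1 / 2 : ℂ) * (T.normalDeriv 0 p x + T.normalDeriv 1 p x)

end Mesh

/-- The jump of `p` over `Γ_I` (in the direction of the normal that points out of `Ω₁`). -/
def jump (D : SplitDomain) (p : E → ℂ) (x : E) : ℂ :=
  trace (D.sub 0) p x - trace (D.sub 1) p x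

/-- The bilinear form `a₀`. -/
def a₀ (D : SplitDomain) (κ : ℝ) (p q : E → ℂ) : ℂ :=
  (∫ x in D.bulk, ∑ j : Fin 3, weakPartial D.bulk j p x * weakPartial D.bulk j q x)
    - (κ : ℂ) ^ 2 * (∫ x in D.bulk, p x * q x)
    + Complex.I * (κ : ℂ) * ∑ i : Fin 2, ∫ x in D.Γio ∩ frontier (D.sub i),
        trace (D.sub i) p x * trace (D.sub i) q x ∂surf

/-- The bilinear form `a_λ` of the Nitsche-type method, for a function `lam` on `Γ_I`. -/
def aLam (D : SplitDomain) (T : D.Mesh) (κ : ℝ) (ζ lam : E → ℂ) (p q : E → ℂ) : ℂ :=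
  D.a₀ κ p q
  - (∫ x in D.ΓI, T.avgFlux p x *
      (D.jump q x + ζ x / (Complex.I * κ) * T.avgFlux q x) ∂surf)
  - (∫ x in D.ΓI, (D.jump p x + ζ x / (Complex.I * κ) * T.avgFlux p x) * T.avgFlux q x ∂surf)
  + (∫ x in D.ΓI, ζ x / (Complex.I * κ) * T.avgFlux p x * T.avgFlux q x ∂surf)
  + (∫ x in D.ΓI, lam x * (D.jump p x + ζ x / (Complex.I * κ) * T.avgFlux p x) *
      (D.jump q x + ζ x / (Complex.I * κ) * T.avgFlux q x) ∂surf)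

/-- The mesh and wave number dependent norm `|||p|||`. -/
def tripleNorm (D : SplitDomain) (T : D.Mesh) (κ γ : ℝ) (lam : E → ℂ) (p : E → ℂ) : ℝ :=
  Real.sqrt (
    (∫ x in D.bulk, ∑ j : Fin 3, ‖weakPartial D.bulk j p x‖ ^ 2)
    + κ ^ 2 * (∫ x in D.bulk, ‖p x‖ ^ 2)
    + 1 / γ * (∫ x in D.ΓI, T.h * ‖T.avgFlux p x‖ ^ 2 ∂surf)
    + (∫ x in D.ΓI, ‖lam x‖ * ‖D.jump p x‖ ^ 2 ∂surf))

end SplitDomain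

/-- The function `λ = (h/γ + ζ/(iκ))⁻¹`. -/
def lamFun (κ γ h : ℝ) (ζ : E → ℂ) (x : E) : ℂ :=
  ((h / γ : ℝ) + ζ x / (Complex.I * κ))⁻¹

end NitscheHelmholtz

end

namespace NitscheHelmholtz

/-! ### The trace inequality on polyhedra -/

/-! Two independent facts carry the proof.

Existence of a trace constant. A tetrahedron's boundary is cut into flat pieces from each of which
an edge direction leads into the tetrahedron for a fixed length; integrating a one-dimensional trace
inequality along these segments gives the estimate for smooth functions. Summing over the finitely
many elements gives it on each subdomain, and the approximating sequence in `IsTrace` carries it to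
H¹ (`Triangulation.exists_integral_trace_le`).

Continuity. Put t = h/γ, z = ζ/(iκ), so that λ = 1/(t + z). The condition on Im ζ says exactly that
the cross term in |t + z|² costs at most half of |z|², so |t + z|² ≥ t² + |z|²/2, and hence |λ|t ≤ 1
and |λ||z| ≤ 2 (`lam_bounds`). Substituting z = 1/λ - t, the four interface integrands collapse to a
form in flux and jump with coefficients -λt, -λzt and λ; these two bounds dominate it by the weights
√t and √|λ| of the triple norm (`norm_interface_le`). Cauchy-Schwarz then finishes the interface
terms with an absolute constant. The flux itself is part of the norm, so no inverse inequality
enters and the constant is free of the mesh and of k. The trace constant c is needed only for the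
integral over Γ_io in `a₀`, and κ enters the bound where ‖p‖ is recovered from κ‖p‖ and through the
factor κ of that integral. -/

/-- A one-dimensional trace inequality. -/
theorem enorm_sq_apply_zero_le {f : ℝ → ℂ} (hf : ContDiff ℝ 1 f) {δ : ℝ} (hδ : 0 < δ) :
    ‖f 0‖ₑ ^ 2 ≤ ENNReal.ofReal (1 / δ + 1) *
      ∫⁻ t in Icc 0 δ, (‖f t‖ₑ ^ 2 + ‖deriv f t‖ₑ ^ 2) := by
  have hf' : Continuous (deriv f) := hf.continuous_deriv le_rfl
  have hd : ∀ t, HasDerivAt f (deriv f t) t := fun t =>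
    (hf.differentiable one_ne_zero t).hasDerivAt
  have hc : Continuous fun t => (1 / δ + 1) * (‖f t‖ ^ 2 + ‖deriv f t‖ ^ 2) := by
    have := hf.continuous
    fun_prop
  -- Derivative of (1 - t/δ)‖f t‖², which is ‖f 0‖² at 0 and vanishes at δ. Its first term yields
  -- the constant 1/δ, the cross term (via 2ab ≤ a² + b²) the constant 1.
  set g' : ℝ → ℝ := fun t =>
    (-(1 / δ)) * ‖f t‖ ^ 2 + (1 - t / δ) * (2 * inner ℝ (f t) (deriv f t)) with hg'
  have hg'c : Continuous g' := by
    have := hf.continuous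
    fun_prop
  have hg : ∀ t, HasDerivAt (fun t => (1 - t / δ) * ‖f t‖ ^ 2) (g' t) t := fun t => by
    have h1 : HasDerivAt (fun t : ℝ => 1 - t / δ) (-(1 / δ)) t :=
      ((hasDerivAt_id t).div_const δ).const_sub 1
    exact h1.mul (hd t).norm_sq
  have hint := intervalIntegral.integral_eq_sub_of_hasDerivAt (a := 0) (b := δ)
    (fun t _ => hg t) (hg'c.intervalIntegrable _ _)
  have hzero : ‖f 0‖ ^ 2 = ∫ t in (0 : ℝ)..δ, -g' t := by
    rw [intervalIntegral.integral_neg, hint]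
    simp [hδ.ne']
  have hreal : ‖f 0‖ ^ 2 ≤ ∫ t in (0 : ℝ)..δ, (1 / δ + 1) * (‖f t‖ ^ 2 + ‖deriv f t‖ ^ 2) := by
    rw [hzero]
    refine intervalIntegral.integral_mono_on hδ.le (hg'c.neg.intervalIntegrable _ _)
      (hc.intervalIntegrable _ _) fun t ht => ?_
    have h1 := abs_real_inner_le_norm (f t) (deriv f t)
    have h2 : 0 ≤ 1 - t / δ := by
      rw [sub_nonneg, div_le_one hδ]; exact ht.2
    have h3 : 1 - t / δ ≤ 1 := by
      have := div_nonneg ht.1 hδ.le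
      linarith
    have h4 : -((1 - t / δ) * (2 * inner ℝ (f t) (deriv f t))) ≤
        ‖f t‖ ^ 2 + ‖deriv f t‖ ^ 2 := by
      have h5 : -(2 * inner ℝ (f t) (deriv f t)) ≤ ‖f t‖ ^ 2 + ‖deriv f t‖ ^ 2 := by
        nlinarith [neg_abs_le (inner ℝ (f t) (deriv f t)), sq_nonneg (‖f t‖ - ‖deriv f t‖)]
      calc -((1 - t / δ) * (2 * inner ℝ (f t) (deriv f t)))
          = (1 - t / δ) * (-(2 * inner ℝ (f t) (deriv f t))) := by ring
        _ ≤ (1 - t / δ) * (‖f t‖ ^ 2 + ‖deriv f t‖ ^ 2) := by gcongr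
        _ ≤ 1 * (‖f t‖ ^ 2 + ‖deriv f t‖ ^ 2) := by gcongr
        _ = _ := one_mul _
    have h6 : 0 ≤ 1 / δ * ‖deriv f t‖ ^ 2 := by positivity
    simp only [hg']
    linarith
  rw [intervalIntegral.integral_of_le hδ.le, ← integral_Icc_eq_integral_Ioc] at hreal
  have hL : ‖f 0‖ₑ ^ 2 = ENNReal.ofReal (‖f 0‖ ^ 2) := by
    rw [ENNReal.ofReal_pow (norm_nonneg _), ofReal_norm]
  rw [hL, ← lintegral_const_mul']
  swap; · exact ENNReal.ofReal_ne_top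
  refine (ENNReal.ofReal_le_ofReal hreal).trans_eq ?_
  rw [ofReal_integral_eq_lintegral_ofReal (hc.continuousOn.integrableOn_Icc)
    (ae_of_all _ fun t => by positivity)]
  refine lintegral_congr fun t => ?_
  rw [ENNReal.ofReal_mul (by positivity),
    ENNReal.ofReal_add (p := ‖f t‖ ^ 2) (by positivity) (by positivity),
    ENNReal.ofReal_pow (norm_nonneg _), ENNReal.ofReal_pow (norm_nonneg _), ofReal_norm,
    ofReal_norm]

/-- The kernel of a nonzero functional on `E` is the range of an isometric copy of the plane. -/
theorem exists_linearIsometry_range_eq_ker (l : E →L[ℝ] ℝ) (hl : l ≠ 0) :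
    ∃ ι : EuclideanSpace ℝ (Fin 2) →ₗᵢ[ℝ] E, ∀ x, l x = 0 ↔ x ∈ range ι := by
  have hrank : Module.finrank ℝ (LinearMap.ker (l : E →ₗ[ℝ] ℝ)) = 2 := by
    have h1 := LinearMap.finrank_range_add_finrank_ker (l : E →ₗ[ℝ] ℝ)
    have h2 : LinearMap.range (l : E →ₗ[ℝ] ℝ) = ⊤ :=
      LinearMap.range_eq_top.2 (LinearMap.surjective (by
        intro h; exact hl (ContinuousLinearMap.coe_injective h)))
    rw [h2] at h1
    simp at h1
    omega
  let e : LinearMap.ker (l : E →ₗ[ℝ] ℝ) ≃ₗᵢ[ℝ] EuclideanSpace ℝ (Fin 2) :=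
    (stdOrthonormalBasis ℝ (LinearMap.ker (l : E →ₗ[ℝ] ℝ))).reindex (finCongr hrank) |>.repr
  refine ⟨(LinearMap.ker (l : E →ₗ[ℝ] ℝ)).subtypeₗᵢ.comp e.symm.toLinearIsometry, fun x => ?_⟩
  constructor
  · intro hx
    exact ⟨e ⟨x, hx⟩, by simp⟩
  · rintro ⟨u, rfl⟩
    exact (e.symm u).2

/-- A trace inequality on a flat piece `F` of the boundary of a set `K` that contains the prism
`F + [0, δ] v`. -/
theorem exists_setLIntegral_surf_le (l : E →L[ℝ] ℝ) (a v : E) (hv : l v ≠ 0) {δ : ℝ}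
    (hδ : 0 < δ) : ∃ C : ℝ≥0∞, C ≠ ⊤ ∧ ∀ F K : Set E, MeasurableSet F → MeasurableSet K →
      (∀ x ∈ F, l (x - a) = 0) → (∀ x ∈ F, ∀ t ∈ Icc 0 δ, x + t • v ∈ K) →
      ∀ φ : E → ℂ, ContDiff ℝ ∞ φ → ∫⁻ x in F, ‖φ x‖ₑ ^ 2 ∂surf ≤
        C * ∫⁻ x in K, (‖φ x‖ₑ ^ 2 + ‖fderiv ℝ φ x‖ₑ ^ 2) := by
  have hl : l ≠ 0 := by rintro rfl; simp at hv
  obtain ⟨ι, hι⟩ := exists_linearIsometry_range_eq_ker l hl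
  -- Oblique coordinates: a point of the plane l = 0 plus a multiple of the transversal v. Since l v
  -- ≠ 0 they are injective.
  let M₀ : (EuclideanSpace ℝ (Fin 2) × ℝ) →ₗ[ℝ] E :=
    ι.toLinearMap.coprod (LinearMap.toSpanSingleton ℝ E v)
  have hM₀ : ∀ u t, M₀ (u, t) = ι u + t • v := fun u t => by simp [M₀]
  have hinj : Function.Injective M₀ := by
    rw [injective_iff_map_eq_zero]
    rintro ⟨u, t⟩ h
    rw [hM₀] at h
    have h1 : t = 0 := by
      have h2 := congrArg l h
      rw [map_add, (hι _).2 ⟨u, rfl⟩] at h2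
      simpa [hv] using h2
    subst h1
    have h3 : u = 0 := ι.injective (by simpa using h)
    simp [h3]
  let M : (EuclideanSpace ℝ (Fin 2) × ℝ) ≃L[ℝ] E :=
    (LinearEquiv.ofInjectiveOfFinrankEq M₀ hinj (by simp)).toContinuousLinearEquiv
  have hM : ∀ u t, M (u, t) = ι u + t • v := hM₀
  have hvol : (volume : Measure (EuclideanSpace ℝ (Fin 2) × ℝ)).IsAddHaarMeasure :=
    inferInstanceAs
      ((volume : Measure (EuclideanSpace ℝ (Fin 2))).prod (volume : Measure ℝ)).IsAddHaarMeasure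
  have hHaar : (Measure.map M volume).IsAddHaarMeasure := M.isAddHaarMeasure_map volume
  -- The Jacobian factor comes from uniqueness of Haar measure; only its finiteness matters.
  obtain ⟨c, hc⟩ : ∃ c : ℝ≥0, Measure.map M volume = c • (volume : Measure E) :=
    ⟨_, Measure.isAddLeftInvariant_eq_smul _ _⟩
  have hmap : Measure.map (fun p => a + M p) volume = c • (volume : Measure E) := by
    rw [show (fun p => a + M p) = (fun x => a + x) ∘ M from rfl,
      ← Measure.map_map (by fun_prop) (by fun_prop), hc, Measure.map_smul,
      (measurePreserving_add_left volume a).map_eq]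
  set A : EuclideanSpace ℝ (Fin 2) → E := fun u => a + ι u with hA
  have hAi : Isometry A := (IsometryEquiv.addLeft a).isometry.comp ι.isometry
  have hAe : MeasurableEmbedding A := hAi.isClosedEmbedding.measurableEmbedding
  refine ⟨ENNReal.ofReal (1 / δ + 1) * (1 + ‖v‖ₑ ^ 2) * c, ?_, ?_⟩
  · finiteness
  intro F K hF hK hFl hFK φ hφ
  set G : E → ℝ≥0∞ := fun x => ‖φ x‖ₑ ^ 2 + ‖fderiv ℝ φ x‖ₑ ^ 2 with hG
  have hφ' : Continuous (fderiv ℝ φ) := hφ.continuous_fderiv (by simp)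
  have hGm : Measurable G := by
    have := hφ.continuous
    exact Continuous.measurable (by fun_prop)
  have hFA : F ⊆ range A := fun x hx => by
    obtain ⟨u, hu⟩ := (hι _).1 (hFl x hx)
    exact ⟨u, by simp [hA, hu]⟩
  have hsurf : ∫⁻ x in F, ‖φ x‖ₑ ^ 2 ∂surf = ∫⁻ u in A ⁻¹' F, ‖φ (A u)‖ₑ ^ 2 := by
    have h1 : surf.restrict F = (Measure.map A volume).restrict F := by
      rw [← EuclideanSpace.euclideanHausdorffMeasure_eq_volume 2,
        hAi.map_euclideanHausdorffMeasure, Measure.restrict_restrict hF,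
        inter_eq_left.2 hFA]
    rw [h1, hAe.restrict_map, hAe.lintegral_map]
  rw [hsurf]
  have hpt : ∀ u, ‖φ (A u)‖ₑ ^ 2 ≤ ENNReal.ofReal (1 / δ + 1) * (1 + ‖v‖ₑ ^ 2) *
      ∫⁻ t in Icc 0 δ, G (a + M (u, t)) := fun u => by
    have hf : ContDiff ℝ 1 fun t : ℝ => φ (A u + t • v) :=
      (hφ.of_le (by simp)).comp (by fun_prop)
    have h1 := enorm_sq_apply_zero_le hf hδ
    simp only [zero_smul, add_zero] at h1
    refine h1.trans ?_
    rw [mul_assoc]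
    gcongr
    rw [← lintegral_const_mul' _ _ (by finiteness)]
    refine lintegral_mono fun t => ?_
    have hx : a + M (u, t) = A u + t • v := by rw [hM, hA, add_assoc]
    have hder : deriv (fun t : ℝ => φ (A u + t • v)) t = fderiv ℝ φ (A u + t • v) v := by
      have h2 : HasDerivAt (fun t : ℝ => A u + t • v) v t := by
        simpa using ((hasDerivAt_id t).smul_const v).const_add (A u)
      exact ((hφ.differentiable (by simp) _).hasFDerivAt.comp_hasDerivAt t h2).deriv
    simp only [hx, hG, hder]
    have h3 : ‖fderiv ℝ φ (A u + t • v) v‖ₑ ^ 2 ≤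
        (‖fderiv ℝ φ (A u + t • v)‖ₑ * ‖v‖ₑ) ^ 2 := by
      gcongr
      exact ContinuousLinearMap.le_opENorm _ _
    calc _ ≤ ‖φ (A u + t • v)‖ₑ ^ 2 + (‖fderiv ℝ φ (A u + t • v)‖ₑ * ‖v‖ₑ) ^ 2 := by gcongr
      -- The added terms complete the product (1 + ‖v‖²)(‖φ‖² + ‖Dφ‖²).
      _ ≤ ‖φ (A u + t • v)‖ₑ ^ 2 + (‖fderiv ℝ φ (A u + t • v)‖ₑ * ‖v‖ₑ) ^ 2 +
          (‖fderiv ℝ φ (A u + t • v)‖ₑ ^ 2 + ‖v‖ₑ ^ 2 * ‖φ (A u + t • v)‖ₑ ^ 2) := le_self_add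
      _ = _ := by ring
  calc ∫⁻ u in A ⁻¹' F, ‖φ (A u)‖ₑ ^ 2
      ≤ ∫⁻ u in A ⁻¹' F, ENNReal.ofReal (1 / δ + 1) * (1 + ‖v‖ₑ ^ 2) *
        ∫⁻ t in Icc 0 δ, G (a + M (u, t)) := lintegral_mono fun u => hpt u
    _ = ENNReal.ofReal (1 / δ + 1) * (1 + ‖v‖ₑ ^ 2) *
        ∫⁻ u in A ⁻¹' F, ∫⁻ t in Icc 0 δ, G (a + M (u, t)) :=
      lintegral_const_mul' _ _ (by finiteness)
    _ = ENNReal.ofReal (1 / δ + 1) * (1 + ‖v‖ₑ ^ 2) *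
        ∫⁻ p in (A ⁻¹' F) ×ˢ (Icc 0 δ), G (a + M p) := by
      rw [Measure.volume_eq_prod, ← Measure.prod_restrict,
        lintegral_prod _ (by fun_prop)]
    _ ≤ ENNReal.ofReal (1 / δ + 1) * (1 + ‖v‖ₑ ^ 2) *
        ∫⁻ p in (fun p => a + M p) ⁻¹' K, G (a + M p) := by
      gcongr
      rintro ⟨u, t⟩ ⟨hu, ht⟩
      have := hFK _ hu t ht
      simpa [hM, hA, add_assoc] using this
    _ = ENNReal.ofReal (1 / δ + 1) * (1 + ‖v‖ₑ ^ 2) * (c * ∫⁻ x in K, G x) := by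
      rw [← setLIntegral_map hK hGm (by fun_prop), hmap, Measure.restrict_smul,
        lintegral_smul_measure, ENNReal.smul_def, smul_eq_mul]
    _ = _ := by rw [mul_assoc _ (c : ℝ≥0∞)]

/-- The trace inequality on a nondegenerate simplex. -/
theorem exists_setLIntegral_surf_simplex_le {ι : Type*} [Fintype ι] (b : AffineBasis ι ℝ E) :
    ∃ C : ℝ≥0∞, C ≠ ⊤ ∧ ∀ φ : E → ℂ, ContDiff ℝ ∞ φ →
      ∫⁻ x in convexHull ℝ (range b) \ interior (convexHull ℝ (range b)), ‖φ x‖ₑ ^ 2 ∂surf ≤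
        C * ∫⁻ x in interior (convexHull ℝ (range b)), (‖φ x‖ₑ ^ 2 + ‖fderiv ℝ φ x‖ₑ ^ 2) := by
  classical
  set K := convexHull ℝ (range b) with hKdef
  have hK : K = {x | ∀ i, 0 ≤ b.coord i x} := b.convexHull_eq_nonneg_coord
  have hKi : interior K = {x | ∀ i, 0 < b.coord i x} := b.interior_convexHull
  have hcont : ∀ i, Continuous (b.coord i) := continuous_barycentric_coord b
  have hKm : MeasurableSet K := by
    rw [hK]
    simp only [ofPred_forall]
    exact MeasurableSet.iInter fun i => measurableSet_le measurable_const (hcont i).measurable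
  -- Barycentric coordinates sum to one, so with this δ every point has some coordinate at least δ.
  obtain ⟨δ, hδ, hδc⟩ : ∃ δ : ℝ, 0 < δ ∧ δ * Fintype.card ι < 1 := by
    refine ⟨1 / (Fintype.card ι + 1), by positivity, ?_⟩
    rw [div_mul_eq_mul_div, one_mul, div_lt_one (by positivity)]
    linarith
  -- On the piece (i, j), moving by t (b i - b j) with 0 ≤ t ≤ δ shifts weight from vertex j to
  -- vertex i, so the point stays in the simplex while leaving the face transversally.
  let F : ι × ι → Set E := fun q => {x | x ∈ K ∧ b.coord q.1 x = 0 ∧ δ ≤ b.coord q.2 x}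
  have hFm : ∀ q, MeasurableSet (F q) := fun q =>
    hKm.inter ((measurableSet_eq_fun (hcont _).measurable measurable_const).inter
      (measurableSet_le measurable_const (hcont _).measurable))
  have hcover : K \ interior K ⊆ ⋃ q, F q := by
    rintro x ⟨hxK, hxi⟩
    have hx0 : ∀ i, 0 ≤ b.coord i x := by rw [hK] at hxK; exact hxK
    obtain ⟨i, hi⟩ : ∃ i, b.coord i x = 0 := by
      by_contra! h
      exact hxi (by rw [hKi]; exact fun i => lt_of_le_of_ne (hx0 i) (h i).symm)
    obtain ⟨j, hj⟩ : ∃ j, δ ≤ b.coord j x := by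
      by_contra! h
      have h1 : ∑ j, b.coord j x ≤ ∑ _j : ι, δ := Finset.sum_le_sum fun j _ => (h j).le
      rw [b.sum_coord_apply_eq_one, Finset.sum_const, nsmul_eq_mul, Finset.card_univ] at h1
      linarith
    exact mem_iUnion.2 ⟨(i, j), hxK, hi, hj⟩
  have hpiece : ∀ q : ι × ι, ∃ C : ℝ≥0∞, C ≠ ⊤ ∧ ∀ φ : E → ℂ, ContDiff ℝ ∞ φ →
      ∫⁻ x in F q, ‖φ x‖ₑ ^ 2 ∂surf ≤ C * ∫⁻ x in K, (‖φ x‖ₑ ^ 2 + ‖fderiv ℝ φ x‖ₑ ^ 2) := by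
    rintro ⟨i, j⟩
    by_cases hij : i = j
    · have hempty : F (i, j) = ∅ := by
        refine eq_empty_of_forall_notMem ?_
        rintro x ⟨-, h1, h2⟩
        simp only [hij] at h1
        simp only [h1] at h2
        linarith
      exact ⟨0, by simp, fun φ _ => by simp [hempty]⟩
    · let l : E →L[ℝ] ℝ := LinearMap.toContinuousLinearMap (b.coord i).linear
      have hl : ∀ x y, l (x - y) = b.coord i x - b.coord i y := fun x y =>
        (b.coord i).linearMap_vsub x y
      have hv : l (b i - b j) = 1 := by rw [hl]; simp [hij]
      obtain ⟨C, hC, h⟩ := exists_setLIntegral_surf_le l (b j) (b i - b j) (by simp [hv]) hδ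
      refine ⟨C, hC, h (F (i, j)) K (hFm _) hKm ?_ ?_⟩
      · rintro x ⟨-, h1, -⟩
        rw [hl, h1]
        simp [hij]
      · rintro x ⟨hxK, h1, h2⟩ t ⟨ht0, htδ⟩
        rw [hK] at hxK ⊢
        intro m
        have hm : b.coord m (x + t • (b i - b j)) =
            b.coord m x + t * (b.coord m (b i) - b.coord m (b j)) := by
          have h3 := (b.coord m).map_vadd x (t • (b i - b j))
          rw [map_smul, ← vsub_eq_sub, (b.coord m).linearMap_vsub] at h3
          simpa [add_comm] using h3
        rw [hm, b.coord_apply, b.coord_apply]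
        have hm0 := hxK m
        by_cases hmi : m = i
        · subst hmi
          simp [hij]
          linarith
        · by_cases hmj : m = j
          · subst hmj
            simp [hmi]
            exact htδ.trans h2
          · simpa [hmi, hmj] using hm0
  choose C hC h using hpiece
  refine ⟨∑ q, C q, by simpa [ENNReal.sum_eq_top] using hC, fun φ hφ => ?_⟩
  have hKae : ∫⁻ x in interior K, (‖φ x‖ₑ ^ 2 + ‖fderiv ℝ φ x‖ₑ ^ 2) =
      ∫⁻ x in K, (‖φ x‖ₑ ^ 2 + ‖fderiv ℝ φ x‖ₑ ^ 2) :=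
    setLIntegral_congr (interior_ae_eq_of_null_frontier
      ((convex_convexHull ℝ _).addHaar_frontier volume))
  rw [hKae, Finset.sum_mul]
  refine (lintegral_mono_set hcover).trans ((lintegral_iUnion_le _ _).trans ?_)
  rw [tsum_fintype]
  exact Finset.sum_le_sum fun q _ => h q φ hφ

/-- The trace inequality on a triangulated polyhedron, for smooth functions. -/
theorem Triangulation.exists_setLIntegral_frontier_le {U : Set E} (T : Triangulation U)
    (hU : IsOpen U) : ∃ C : ℝ≥0∞, C ≠ ⊤ ∧ ∀ φ : E → ℂ, ContDiff ℝ ∞ φ →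
      ∫⁻ x in frontier U, ‖φ x‖ₑ ^ 2 ∂surf ≤
        C * ∫⁻ x in U, (‖φ x‖ₑ ^ 2 + ‖fderiv ℝ φ x‖ₑ ^ 2) := by
  classical
  let I : Set (Finset E) := {s ∈ T.complex.faces | s.card = 4}
  have hIfin : I.Finite := T.finite.subset fun s hs => hs.1
  have : Fintype I := hIfin.fintype
  have hcell : ∀ s : I, ∃ C : ℝ≥0∞, C ≠ ⊤ ∧ ∀ φ : E → ℂ, ContDiff ℝ ∞ φ →
      ∫⁻ x in convexHull ℝ (s.1 : Set E) \ interior (convexHull ℝ (s.1 : Set E)),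
        ‖φ x‖ₑ ^ 2 ∂surf ≤
          C * ∫⁻ x in interior (convexHull ℝ (s.1 : Set E)),
            (‖φ x‖ₑ ^ 2 + ‖fderiv ℝ φ x‖ₑ ^ 2) := by
    rintro ⟨s, hs, hcard⟩
    have hind := T.complex.indep hs
    let b : AffineBasis s ℝ E := ⟨(↑), hind, by
      rw [hind.affineSpan_eq_top_iff_card_eq_finrank_add_one]
      simp [hcard]⟩
    have hb : range b = (s : Set E) := Subtype.range_coe
    simpa only [hb] using exists_setLIntegral_surf_simplex_le b
  choose C hC h using hcell
  refine ⟨∑ s, C s, by simpa [ENNReal.sum_eq_top] using hC, fun φ hφ => ?_⟩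
  -- A boundary point lies in some closed tetrahedron but not in its interior, because interiors of
  -- elements are contained in the open set U.
  have hcover : frontier U ⊆
      ⋃ s : I, convexHull ℝ (s.1 : Set E) \ interior (convexHull ℝ (s.1 : Set E)) := by
    intro x hx
    rw [hU.frontier_eq, ← T.cover] at hx
    obtain ⟨hx, hxU⟩ := hx
    obtain ⟨s, hs, hxs⟩ := Geometry.SimplicialComplex.mem_space_iff.1 hx
    obtain ⟨t, ht, hst, hcard⟩ := T.pure s hs
    exact mem_iUnion.2 ⟨⟨t, ht, hcard⟩, convexHull_mono (by exact_mod_cast hst) hxs,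
      fun hxi => hxU (T.interior_subset t ht hxi)⟩
  rw [Finset.sum_mul]
  refine (lintegral_mono_set hcover).trans ((lintegral_iUnion_le _ _).trans ?_)
  rw [tsum_fintype]
  refine Finset.sum_le_sum fun s _ => (h s φ hφ).trans ?_
  gcongr
  exact T.interior_subset s.1 s.2.1

/-! ### From smooth functions to Sobolev traces -/

theorem eLpNorm_two_sq {F : Type*} [NormedAddCommGroup F] (μ : Measure E) (f : E → F) :
    eLpNorm f 2 μ ^ 2 = ∫⁻ x, ‖f x‖ₑ ^ 2 ∂μ := by
  have := eLpNorm_nnreal_pow_eq_lintegral (μ := μ) (f := f) (p := 2) (by simp)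
  simpa only [NNReal.coe_ofNat, ENNReal.coe_ofNat, ENNReal.rpow_ofNat] using this

theorem integral_norm_sq_eq {F : Type*} [NormedAddCommGroup F] {μ : Measure E} {f : E → F}
    (hf : MemLp f 2 μ) : ∫ x, ‖f x‖ ^ 2 ∂μ = (eLpNorm f 2 μ).toReal ^ 2 := by
  rw [← ENNReal.toReal_pow, eLpNorm_two_sq, integral_eq_lintegral_of_nonneg_ae
    (ae_of_all _ fun x => by positivity) (by exact hf.1.norm.pow 2)]
  congr 1
  refine lintegral_congr fun x => ?_
  rw [ENNReal.ofReal_pow (norm_nonneg _), ofReal_norm]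

theorem memLp_weakPartial (U : Set E) (j : Fin 3) (u : E → ℂ) :
    MemLp (weakPartial U j u) 2 (volume.restrict U) := by
  unfold weakPartial
  split_ifs with h
  · exact h.choose_spec.1
  · exact MemLp.zero

/-- Makes existence of traces unnecessary for upper bounds: the default value 0 satisfies them
trivially. -/
theorem isTrace_trace_or_eq_zero (U : Set E) (u : E → ℂ) :
    IsTrace U (frontier U) u (trace U u) ∨ trace U u = 0 := by
  unfold trace
  split_ifs with h
  · exact Or.inl h.choose_spec
  · exact Or.inr rfl

theorem memLp_trace (U : Set E) (u : E → ℂ) :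
    MemLp (trace U u) 2 (surf.restrict (frontier U)) := by
  rcases isTrace_trace_or_eq_zero U u with h | h
  · exact h.2.1
  · rw [h]; exact MemLp.zero

/-- Links the operator norm in the smooth trace inequality to the partial derivatives whose
convergence `IsTrace` provides. -/
theorem eLpNorm_fderiv_le (μ : Measure E) {φ : E → ℂ} (hφ : ContDiff ℝ ∞ φ) :
    eLpNorm (fderiv ℝ φ) 2 μ ≤ ∑ j : Fin 3, eLpNorm (fun x => fderiv ℝ φ x (unitVec j)) 2 μ := by
  have hφ' : Continuous (fderiv ℝ φ) := hφ.continuous_fderiv (by simp)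
  have hpt : ∀ L : E →L[ℝ] ℂ, ‖L‖ ≤ ∑ j : Fin 3, ‖L (unitVec j)‖ := fun L => by
    refine L.opNorm_le_bound (by positivity) fun x => ?_
    have hx : x = ∑ j : Fin 3, x j • unitVec j := by
      ext i
      fin_cases i <;> simp [Fin.sum_univ_three]
    calc ‖L x‖ = ‖∑ j : Fin 3, x j • L (unitVec j)‖ := by
          conv_lhs => rw [hx]
          simp [map_sum]
      _ ≤ ∑ j : Fin 3, ‖x j • L (unitVec j)‖ := norm_sum_le _ _
      _ ≤ ∑ j : Fin 3, ‖L (unitVec j)‖ * ‖x‖ := by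
          refine Finset.sum_le_sum fun j _ => ?_
          rw [norm_smul, mul_comm]
          gcongr
          exact PiLp.norm_apply_le x j
      _ = _ := by rw [Finset.sum_mul]
  calc eLpNorm (fderiv ℝ φ) 2 μ
      ≤ eLpNorm (∑ j : Fin 3, fun x => ‖fderiv ℝ φ x (unitVec j)‖) 2 μ := by
        refine eLpNorm_mono_real fun x => ?_
        simpa using hpt (fderiv ℝ φ x)
    _ ≤ ∑ j : Fin 3, eLpNorm (fun x => ‖fderiv ℝ φ x (unitVec j)‖) 2 μ :=
        eLpNorm_sum_le (fun j _ => Continuous.aestronglyMeasurable (by fun_prop)) (by norm_num)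
    _ = _ := by simp only [eLpNorm_norm]

theorem sobolevNormSq_nonneg (U : Set E) (u : E → ℂ) : 0 ≤ sobolevNormSq U u :=
  add_nonneg (integral_nonneg fun x => by positivity)
    (Finset.sum_nonneg fun j _ => integral_nonneg fun x => by positivity)

/-- The trace inequality on a triangulated polyhedron. -/
theorem Triangulation.exists_integral_trace_le {U : Set E} (T : Triangulation U)
    (hU : IsOpen U) : ∃ c : ℝ, 0 ≤ c ∧ ∀ p : E → ℂ,
      ∫ x in frontier U, ‖trace U p x‖ ^ 2 ∂surf ≤ c ^ 2 * sobolevNormSq U p := by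
  obtain ⟨C, hC, h⟩ := T.exists_setLIntegral_frontier_le hU
  have hsmooth : ∀ φ : E → ℂ, ContDiff ℝ ∞ φ → eLpNorm φ 2 (surf.restrict (frontier U)) ≤
      (C + 1) * (eLpNorm φ 2 (volume.restrict U) +
        ∑ j : Fin 3, eLpNorm (fun x => fderiv ℝ φ x (unitVec j)) 2 (volume.restrict U)) := by
    intro φ hφ
    rw [← ENNReal.pow_le_pow_left_iff two_ne_zero, eLpNorm_two_sq]
    refine (h φ hφ).trans ?_
    rw [lintegral_add_left (by have := hφ.continuous; exact Continuous.measurable (by fun_prop)),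
      ← eLpNorm_two_sq, ← eLpNorm_two_sq, mul_pow]
    -- Using C + 1 in place of √C avoids a square root.
    have h1 : C ≤ (C + 1) ^ 2 := by
      calc C ≤ C + (C ^ 2 + C + 1) := le_self_add
        _ = (C + 1) ^ 2 := by ring
    have h2 := eLpNorm_fderiv_le (volume.restrict U) hφ
    gcongr
    calc _ ≤ eLpNorm φ 2 (volume.restrict U) ^ 2 +
          (∑ j : Fin 3, eLpNorm (fun x => fderiv ℝ φ x (unitVec j)) 2 (volume.restrict U)) ^ 2 := by
          gcongr
      _ ≤ _ := by
          rw [add_sq, add_right_comm]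
          exact le_self_add
  -- The 2 is √4, from comparing the square of a sum of four norms with the sum of their squares.
  refine ⟨2 * (C + 1).toReal, by positivity, fun p => ?_⟩
  have hnn := sobolevNormSq_nonneg U p
  rcases isTrace_trace_or_eq_zero U p with ht | ht
  swap
  · simp only [ht, Pi.zero_apply, norm_zero, ne_eq, OfNat.ofNat_ne_zero, not_false_eq_true,
      zero_pow, integral_zero]
    positivity
  obtain ⟨hp, hg, φ, hφ, hφ0, hφ1, hφg⟩ := ht
  have hp0 : MemLp p 2 (volume.restrict U) := hp.1
  have hw := fun j => memLp_weakPartial U j p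
  set g := trace U p with hgdef
  -- The zeros are the limits of the approximation errors left by the triangle inequality.
  have hlim : eLpNorm g 2 (surf.restrict (frontier U)) ≤ 0 + (C + 1) *
      ((0 + eLpNorm p 2 (volume.restrict U)) +
        ∑ j : Fin 3, (0 + eLpNorm (weakPartial U j p) 2 (volume.restrict U))) := by
    refine ge_of_tendsto' (hφg.add (ENNReal.Tendsto.const_mul ((hφ0.add_const _).add
      (tendsto_finsetSum _ fun j _ => (hφ1 j).add_const _)) (Or.inr (by finiteness))))
      fun n => ?_
    have hφc := (hφ n).continuous
    have hφ' : Continuous (fderiv ℝ (φ n)) := (hφ n).continuous_fderiv (by simp)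
    have h1 : eLpNorm g 2 (surf.restrict (frontier U)) ≤
        eLpNorm (fun x => φ n x - g x) 2 (surf.restrict (frontier U)) +
          eLpNorm (φ n) 2 (surf.restrict (frontier U)) := by
      have h2 := eLpNorm_sub_le (p := 2) (hφc.aestronglyMeasurable (μ := surf.restrict (frontier U)))
        (hφc.aestronglyMeasurable.sub hg.1) (by norm_num)
      rw [add_comm]
      rwa [sub_sub_cancel] at h2
    have hsplit : ∀ (f w : E → ℂ), AEStronglyMeasurable f (volume.restrict U) →
        AEStronglyMeasurable w (volume.restrict U) → eLpNorm f 2 (volume.restrict U) ≤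
          eLpNorm (fun x => f x - w x) 2 (volume.restrict U) +
            eLpNorm w 2 (volume.restrict U) := fun f w hf hw => by
      have h2 := eLpNorm_add_le (p := 2) (hf.sub hw) hw (by norm_num)
      rwa [sub_add_cancel] at h2
    refine h1.trans ?_
    gcongr
    refine (hsmooth (φ n) (hφ n)).trans ?_
    gcongr with j
    · exact hsplit _ _ hφc.aestronglyMeasurable hp0.1
    · exact hsplit _ _ (Continuous.aestronglyMeasurable (by fun_prop)) (hw j).1
  simp only [zero_add] at hlim
  have hfin : (C + 1) * (eLpNorm p 2 (volume.restrict U) +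
      ∑ j : Fin 3, eLpNorm (weakPartial U j p) 2 (volume.restrict U)) ≠ ⊤ := by
    refine ENNReal.mul_ne_top (by finiteness) (ENNReal.add_ne_top.2 ⟨hp0.2.ne, ?_⟩)
    exact ENNReal.sum_ne_top.2 fun j _ => (hw j).2.ne
  have hreal := ENNReal.toReal_mono hfin hlim
  rw [ENNReal.toReal_mul, ENNReal.toReal_add hp0.2.ne
    (ENNReal.sum_ne_top.2 fun j _ => (hw j).2.ne), ENNReal.toReal_sum fun j _ => (hw j).2.ne]
    at hreal
  rw [integral_norm_sq_eq hg, sobolevNormSq, integral_norm_sq_eq hp0]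
  simp only [integral_norm_sq_eq (hw _)]
  calc _ ≤ _ := pow_le_pow_left₀ ENNReal.toReal_nonneg hreal 2
    _ ≤ _ := by
      rw [mul_pow, mul_pow (2 : ℝ), mul_comm ((2 : ℝ) ^ 2), mul_assoc]
      gcongr
      simp only [Fin.sum_univ_three]
      set A := (eLpNorm p 2 (volume.restrict U)).toReal
      set W := fun j => (eLpNorm (weakPartial U j p) 2 (volume.restrict U)).toReal
      change (A + (W 0 + W 1 + W 2)) ^ 2 ≤ 2 ^ 2 * (A ^ 2 + (W 0 ^ 2 + W 1 ^ 2 + W 2 ^ 2))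
      nlinarith [sq_nonneg (A - W 0), sq_nonneg (A - W 1), sq_nonneg (A - W 2),
        sq_nonneg (W 0 - W 1), sq_nonneg (W 0 - W 2), sq_nonneg (W 1 - W 2)]

theorem SplitDomain.Mesh.exists_isTraceConstant {D : SplitDomain} (T : D.Mesh) :
    ∃ c, D.IsTraceConstant c := by
  have h := fun i => (T.tri i).exists_integral_trace_le (D.sub_open i)
  choose c hc h using h
  refine ⟨c 0 + c 1, add_nonneg (hc 0) (hc 1), fun i p _ => (h i p).trans ?_⟩
  have hci : c i ≤ c 0 + c 1 := by
    fin_cases i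
    · simpa using hc 1
    · simpa using hc 0
  have hnn := sobolevNormSq_nonneg (D.sub i) p
  have := hc i
  gcongr

/-! ### Weak derivatives -/

theorem MemSobolev.memLp {U : Set E} {m : ℕ} {u : E → ℂ} (h : MemSobolev U m u) :
    MemLp u 2 (volume.restrict U) := by
  cases m with
  | zero => exact h
  | succ m => exact h.1

theorem MemSobolev.of_succ {U : Set E} {m : ℕ} {u : E → ℂ} (h : MemSobolev U (m + 1) u) :
    MemSobolev U m u := by
  induction m generalizing u with
  | zero => exact h.1
  | succ m ih =>
    refine ⟨h.1, fun j => ?_⟩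
    obtain ⟨v, hv, hm⟩ := h.2 j
    exact ⟨v, hv, ih hm⟩

theorem MemSobolev.hasWeakPartial {U : Set E} {u : E → ℂ} (h : MemSobolev U 1 u) (j : Fin 3) :
    HasWeakPartial U j u (weakPartial U j u) := by
  obtain ⟨v, hv, hm⟩ := h.2 j
  have hex : ∃ v : E → ℂ, MemLp v 2 (volume.restrict U) ∧ HasWeakPartial U j u v := ⟨v, hm, hv⟩
  unfold weakPartial
  rw [dif_pos hex]
  exact hex.choose_spec.2

theorem integrable_testFunction_smul {U : Set E} {φ : E → ℝ} (hφ : ContDiff ℝ ∞ φ)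
    (hc : HasCompactSupport φ) {u : E → ℂ} (hu : MemLp u 2 (volume.restrict U)) :
    Integrable (fun x => φ x • u x) (volume.restrict U) :=
  memLp_one_iff_integrable.1
    (hu.smul (hφ.continuous.memLp_of_hasCompactSupport (p := 2) hc) (r := 1))

theorem integrable_fderiv_testFunction_smul {U : Set E} {φ : E → ℝ} (hφ : ContDiff ℝ ∞ φ)
    (hc : HasCompactSupport φ) (w : E) {u : E → ℂ} (hu : MemLp u 2 (volume.restrict U)) :
    Integrable (fun x => (fderiv ℝ φ x w) • u x) (volume.restrict U) :=
  have hcont : Continuous fun x => fderiv ℝ φ x w :=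
    (hφ.continuous_fderiv (by simp)).clm_apply continuous_const
  memLp_one_iff_integrable.1
    (hu.smul (hcont.memLp_of_hasCompactSupport (p := 2) (hc.fderiv_apply ℝ w)) (r := 1))

theorem HasWeakPartial.add {U : Set E} {j : Fin 3} {u₁ u₂ v₁ v₂ : E → ℂ}
    (h₁ : HasWeakPartial U j u₁ v₁) (h₂ : HasWeakPartial U j u₂ v₂)
    (hu₁ : MemLp u₁ 2 (volume.restrict U)) (hu₂ : MemLp u₂ 2 (volume.restrict U))
    (hv₁ : MemLp v₁ 2 (volume.restrict U)) (hv₂ : MemLp v₂ 2 (volume.restrict U)) :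
    HasWeakPartial U j (u₁ + u₂) (v₁ + v₂) := by
  intro φ hφ hc hs
  simp only [Pi.add_apply, smul_add]
  rw [integral_add (integrable_fderiv_testFunction_smul hφ hc _ hu₁)
      (integrable_fderiv_testFunction_smul hφ hc _ hu₂),
    integral_add (integrable_testFunction_smul hφ hc hv₁) (integrable_testFunction_smul hφ hc hv₂),
    h₁ φ hφ hc hs, h₂ φ hφ hc hs, neg_add]

theorem MemSobolev.add {U : Set E} {m : ℕ} {u v : E → ℂ} (hu : MemSobolev U m u)
    (hv : MemSobolev U m v) : MemSobolev U m (u + v) := by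
  induction m generalizing u v with
  | zero => exact MemLp.add hu hv
  | succ m ih =>
    refine ⟨hu.1.add hv.1, fun j => ?_⟩
    obtain ⟨u', hu', hum⟩ := hu.2 j
    obtain ⟨v', hv', hvm⟩ := hv.2 j
    exact ⟨u' + v', hu'.add hv' hu.1 hv.1 hum.memLp hvm.memLp, ih hum hvm⟩

theorem HasWeakPartial.mono {U V : Set E} (hU : IsOpen U) (hVU : V ⊆ U) {j : Fin 3}
    {u v : E → ℂ} (h : HasWeakPartial U j u v) : HasWeakPartial V j u v := by
  intro φ hφ hc hs
  have h1 := h φ hφ hc (hs.trans hVU)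
  rwa [setIntegral_eq_of_subset_of_forall_sdiff_eq_zero hU.measurableSet hVU,
    setIntegral_eq_of_subset_of_forall_sdiff_eq_zero hU.measurableSet hVU] at h1
  · rintro x ⟨-, hx⟩
    rw [image_eq_zero_of_notMem_tsupport fun hx' => hx (hs hx'), zero_smul]
  · rintro x ⟨-, hx⟩
    have hz : fderiv ℝ φ x (unitVec j) = 0 := image_eq_zero_of_notMem_tsupport
      (f := fun x => fderiv ℝ φ x (unitVec j))
      fun hx' => hx (hs (tsupport_fderiv_apply_subset ℝ _ hx'))
    rw [hz, zero_smul]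

/-- The difference of two weak derivatives integrates to zero against every test function; the
fundamental lemma of the calculus of variations applies. -/
theorem HasWeakPartial.ae_eq {U : Set E} (hU : IsOpen U) {j : Fin 3} {u v w : E → ℂ}
    (hv : HasWeakPartial U j u v) (hw : HasWeakPartial U j u w)
    (hv2 : MemLp v 2 (volume.restrict U)) (hw2 : MemLp w 2 (volume.restrict U)) :
    v =ᵐ[volume.restrict U] w := by
  have hloc : LocallyIntegrableOn (v - w) U volume :=
    locallyIntegrableOn_of_locallyIntegrable_restrict
      ((hv2.sub hw2).locallyIntegrable (by norm_num))
  have hzero := hU.ae_eq_zero_of_integral_contDiff_smul_eq_zero hloc fun φ hφ hc hs => by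
    rw [← setIntegral_eq_integral_of_forall_compl_eq_zero (s := U) fun x hx => by
      rw [image_eq_zero_of_notMem_tsupport fun hx' => hx (hs hx'), zero_smul]]
    simp only [Pi.sub_apply, smul_sub]
    rw [integral_sub (integrable_testFunction_smul hφ hc hv2)
      (integrable_testFunction_smul hφ hc hw2), sub_eq_zero]
    exact neg_injective ((hv φ hφ hc hs).symm.trans (hw φ hφ hc hs))
  filter_upwards [(ae_restrict_iff' hU.measurableSet).2 hzero] with x hx
  exact sub_eq_zero.1 hx

theorem MemSobolev.mono {U V : Set E} (hU : IsOpen U) (hVU : V ⊆ U) {m : ℕ} {u : E → ℂ}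
    (h : MemSobolev U m u) : MemSobolev V m u := by
  induction m generalizing u with
  | zero => exact MemLp.mono_measure (Measure.restrict_mono hVU le_rfl) h
  | succ m ih =>
    refine ⟨h.1.mono_measure (Measure.restrict_mono hVU le_rfl), fun j => ?_⟩
    obtain ⟨v, hv, hm⟩ := h.2 j
    exact ⟨v, hv.mono hU hVU, ih hm⟩

/-- Representatives are chosen separately on each open set. This reconciles derivatives on Ω_i, used
by the trace inequality, with those on Ω₁ ∪ Ω₂, used by the norm. -/
theorem MemSobolev.weakPartial_ae_eq {U V : Set E} (hU : IsOpen U) (hV : IsOpen V)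
    (hVU : V ⊆ U) {u : E → ℂ} (h : MemSobolev U 1 u) (j : Fin 3) :
    weakPartial V j u =ᵐ[volume.restrict V] weakPartial U j u :=
  ((h.mono hU hVU).hasWeakPartial j).ae_eq hV ((h.hasWeakPartial j).mono hU hVU)
    (memLp_weakPartial V j u)
    ((memLp_weakPartial U j u).mono_measure (Measure.restrict_mono hVU le_rfl))

theorem setIntegral_norm_sq_mono {μ : Measure E} {s t : Set E} (hst : s ⊆ t) {f : E → ℂ}
    (hf : MemLp f 2 (μ.restrict t)) : ∫ x in s, ‖f x‖ ^ 2 ∂μ ≤ ∫ x in t, ‖f x‖ ^ 2 ∂μ :=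
  setIntegral_mono_set (hf.integrable_norm_pow (p := 2) two_ne_zero)
    (ae_of_all _ fun x => by positivity) hst.eventuallyLE

theorem MemSobolev.sobolevNormSq_le {U V : Set E} (hU : IsOpen U) (hV : IsOpen V) (hVU : V ⊆ U)
    {u : E → ℂ} (h : MemSobolev U 1 u) : sobolevNormSq V u ≤ sobolevNormSq U u := by
  unfold sobolevNormSq
  refine add_le_add (setIntegral_norm_sq_mono hVU h.memLp) (Finset.sum_le_sum fun j _ => ?_)
  refine le_of_eq_of_le (integral_congr_ae ?_)
    (setIntegral_norm_sq_mono hVU (memLp_weakPartial U j u))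
  filter_upwards [h.weakPartial_ae_eq hU hV hVU j] with x hx
  rw [hx]

/-! ### The Cauchy-Schwarz inequality -/

theorem norm_integral_le_sqrt_mul_sqrt {μ : Measure E} {F : E → ℂ} {f g : E → ℝ}
    (hf : MemLp f 2 μ) (hg : MemLp g 2 μ) (hf0 : ∀ x, 0 ≤ f x) (hg0 : ∀ x, 0 ≤ g x)
    (h : ∀ᵐ x ∂μ, ‖F x‖ ≤ f x * g x) :
    ‖∫ x, F x ∂μ‖ ≤ √(∫ x, f x ^ 2 ∂μ) * √(∫ x, g x ^ 2 ∂μ) := by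
  have h1 := integral_mul_le_Lp_mul_Lq_of_nonneg Real.HolderConjugate.two_two
    (ae_of_all μ hf0) (ae_of_all μ hg0) (by simpa using hf) (by simpa using hg)
  simp only [Real.rpow_two, ← Real.sqrt_eq_rpow] at h1
  exact (norm_integral_le_of_norm_le (hf.integrable_mul hg) h).trans h1

theorem norm_integral_mul_le {μ : Measure E} {f g : E → ℂ} (hf : MemLp f 2 μ)
    (hg : MemLp g 2 μ) :
    ‖∫ x, f x * g x ∂μ‖ ≤ √(∫ x, ‖f x‖ ^ 2 ∂μ) * √(∫ x, ‖g x‖ ^ 2 ∂μ) :=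
  norm_integral_le_sqrt_mul_sqrt hf.norm hg.norm (fun _ => norm_nonneg _)
    (fun _ => norm_nonneg _) (ae_of_all _ fun _ => (norm_mul _ _).le)

/-! ### Continuity of the bilinear form -/

/-- The real part of ζ/(iκ) is Im ζ/κ, so the hypothesis bounds the cross term 2(h/γ)(Im ζ/κ) below
by -|ζ/(iκ)|²/2. The sharp second constant is √2; 2 is enough. -/
theorem lam_bounds {κ γ h : ℝ} (hκ : 0 < κ) (hγ : 0 < γ) (hh : 0 < h) {ζ : ℂ}
    (hζ : h * ζ.im ≥ -(γ / (4 * κ)) * ‖ζ‖ ^ 2) :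
    ((h / γ : ℝ) : ℂ) + ζ / (Complex.I * κ) ≠ 0 ∧
    ‖(((h / γ : ℝ) : ℂ) + ζ / (Complex.I * κ))⁻¹‖ * (h / γ) ≤ 1 ∧
    ‖(((h / γ : ℝ) : ℂ) + ζ / (Complex.I * κ))⁻¹‖ * ‖ζ / (Complex.I * κ)‖ ≤ 2 := by
  have hz : ζ / (Complex.I * κ) = ⟨ζ.im / κ, -(ζ.re / κ)⟩ := by
    have hκ' : (κ : ℂ) ≠ 0 := by exact_mod_cast hκ.ne'
    rw [div_eq_iff (mul_ne_zero Complex.I_ne_zero hκ')]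
    apply Complex.ext <;> simp <;> field_simp
  set z := ζ / (Complex.I * κ) with hzdef
  set w := ((h / γ : ℝ) : ℂ) + z with hw
  have hhγ : 0 < h / γ := div_pos hh hγ
  have hζn : ‖ζ‖ ^ 2 = ζ.re ^ 2 + ζ.im ^ 2 := by
    rw [← Complex.normSq_eq_norm_sq, Complex.normSq_apply]; ring
  have hzn : ‖z‖ ^ 2 = (ζ.re ^ 2 + ζ.im ^ 2) / κ ^ 2 := by
    rw [← Complex.normSq_eq_norm_sq, Complex.normSq_apply, hz]
    field_simp
    ring
  have hwn : ‖w‖ ^ 2 = (h / γ) ^ 2 + 2 * (h / γ) * (ζ.im / κ) + ‖z‖ ^ 2 := by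
    rw [hzn, ← Complex.normSq_eq_norm_sq, Complex.normSq_apply, hw, hz]
    simp
    field_simp
    ring
  have hkey : (h / γ) ^ 2 + ‖z‖ ^ 2 / 2 ≤ ‖w‖ ^ 2 := by
    have h1 : -(‖z‖ ^ 2 / 2) ≤ 2 * (h / γ) * (ζ.im / κ) := by
      have h2 : 2 * (h / γ) * (ζ.im / κ) = (2 / (γ * κ)) * (h * ζ.im) := by field_simp
      have h3 : -(‖z‖ ^ 2 / 2) = (2 / (γ * κ)) * (-(γ / (4 * κ)) * ‖ζ‖ ^ 2) := by
        rw [hzn, hζn]; field_simp; norm_num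
      rw [h2, h3]
      have : 0 ≤ 2 / (γ * κ) := by positivity
      gcongr
    linarith
  have hw0 : 0 < ‖w‖ := by
    by_contra hc
    have : ‖w‖ = 0 := le_antisymm (not_lt.1 hc) (norm_nonneg _)
    rw [this] at hkey
    nlinarith [sq_nonneg ‖z‖, pow_pos hhγ 2]
  refine ⟨norm_pos_iff.1 hw0, ?_, ?_⟩
  · rw [norm_inv, inv_mul_le_iff₀ hw0, mul_one]
    exact abs_le_of_sq_le_sq' (by nlinarith [sq_nonneg ‖z‖]) hw0.le |>.2
  · rw [norm_inv, inv_mul_le_iff₀ hw0]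
    refine (abs_le_of_sq_le_sq' ?_ (by positivity)).2
    nlinarith [sq_nonneg (h / γ), sq_nonneg ‖w‖]

/-- The pointwise estimate of the interface terms of the bilinear form. -/
theorem norm_interface_le {z w P Q Jp Jq : ℂ} {t : ℝ} (ht : 0 < t) (hw : w ≠ 0)
    (hwt : w = (t : ℂ) + z) (h1 : ‖w⁻¹‖ * t ≤ 1) (h2 : ‖w⁻¹‖ * ‖z‖ ≤ 2) :
    ‖-(P * (Jq + z * Q)) - (Jp + z * P) * Q + z * P * Q + w⁻¹ * (Jp + z * P) * (Jq + z * Q)‖ ≤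
      (√2 * (√t * ‖P‖ + √‖w⁻¹‖ * ‖Jp‖)) * (√2 * (√t * ‖Q‖ + √‖w⁻¹‖ * ‖Jq‖)) := by
  -- The cancellation behind the method: w⁻¹z - 1 = -w⁻¹t, so no coefficient containing z survives
  -- without the factor w⁻¹.
  have hid : -(P * (Jq + z * Q)) - (Jp + z * P) * Q + z * P * Q +
      w⁻¹ * (Jp + z * P) * (Jq + z * Q) =
      -(w⁻¹ * t * (P * Jq)) - w⁻¹ * t * (Jp * Q) - w⁻¹ * z * t * (P * Q) + w⁻¹ * (Jp * Jq) := by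
    have hz : z = w - t := by rw [hwt]; ring
    rw [hz]
    field_simp
    ring
  rw [hid]
  set s := √‖w⁻¹‖ with hs
  set r := √t with hr
  have hs0 : 0 ≤ s := Real.sqrt_nonneg _
  have hr0 : 0 ≤ r := Real.sqrt_nonneg _
  have hss : ‖w⁻¹‖ = s * s := (Real.mul_self_sqrt (norm_nonneg _)).symm
  have hrr : t = r * r := (Real.mul_self_sqrt ht.le).symm
  -- In each mixed term |w⁻¹|t = (sr)², and one factor sr is absorbed by this bound while the other
  -- supplies the weights.
  have hsr : s * r ≤ 1 := by
    rw [hss, hrr] at h1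
    nlinarith [mul_nonneg hs0 hr0]
  have hn : ‖-(w⁻¹ * t * (P * Jq)) - w⁻¹ * t * (Jp * Q) - w⁻¹ * z * t * (P * Q) +
      w⁻¹ * (Jp * Jq)‖ ≤ ‖w⁻¹‖ * t * (‖P‖ * ‖Jq‖) + ‖w⁻¹‖ * t * (‖Jp‖ * ‖Q‖) +
        ‖w⁻¹‖ * ‖z‖ * t * (‖P‖ * ‖Q‖) + ‖w⁻¹‖ * (‖Jp‖ * ‖Jq‖) := by
    refine (norm_add_le _ _).trans (add_le_add ((norm_sub_le _ _).trans (add_le_add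
      ((norm_sub_le _ _).trans (add_le_add ?_ ?_)) ?_)) ?_) <;>
      simp [abs_of_pos ht]
  have e1 : ‖w⁻¹‖ * t * (‖P‖ * ‖Jq‖) ≤ (r * ‖P‖) * (s * ‖Jq‖) := by
    calc ‖w⁻¹‖ * t * (‖P‖ * ‖Jq‖) = (s * r) * ((r * ‖P‖) * (s * ‖Jq‖)) := by
          rw [hss, hrr]; ring
      _ ≤ 1 * ((r * ‖P‖) * (s * ‖Jq‖)) := by gcongr
      _ = _ := one_mul _
  have e2 : ‖w⁻¹‖ * t * (‖Jp‖ * ‖Q‖) ≤ (s * ‖Jp‖) * (r * ‖Q‖) := by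
    calc ‖w⁻¹‖ * t * (‖Jp‖ * ‖Q‖) = (s * r) * ((s * ‖Jp‖) * (r * ‖Q‖)) := by
          rw [hss, hrr]; ring
      _ ≤ 1 * ((s * ‖Jp‖) * (r * ‖Q‖)) := by gcongr
      _ = _ := one_mul _
  have e3 : ‖w⁻¹‖ * ‖z‖ * t * (‖P‖ * ‖Q‖) ≤ 2 * ((r * ‖P‖) * (r * ‖Q‖)) := by
    calc ‖w⁻¹‖ * ‖z‖ * t * (‖P‖ * ‖Q‖) ≤ 2 * t * (‖P‖ * ‖Q‖) := by gcongr
      _ = _ := by rw [hrr]; ring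
  have e4 : ‖w⁻¹‖ * (‖Jp‖ * ‖Jq‖) = (s * ‖Jp‖) * (s * ‖Jq‖) := by rw [hss]; ring
  -- The total factor 2 is forced by the flux-flux term `e3` and is split evenly between p and q.
  have h22 : √2 * √2 = (2 : ℝ) := Real.mul_self_sqrt (by norm_num)
  have hfin : (√2 * (r * ‖P‖ + s * ‖Jp‖)) * (√2 * (r * ‖Q‖ + s * ‖Jq‖)) =
      2 * ((r * ‖P‖ + s * ‖Jp‖) * (r * ‖Q‖ + s * ‖Jq‖)) := by
    linear_combination ((r * ‖P‖ + s * ‖Jp‖) * (r * ‖Q‖ + s * ‖Jq‖)) * h22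
  rw [hfin]
  have p1 : 0 ≤ (r * ‖P‖) * (s * ‖Jq‖) := by positivity
  have p2 : 0 ≤ (s * ‖Jp‖) * (r * ‖Q‖) := by positivity
  have p4 : 0 ≤ (s * ‖Jp‖) * (s * ‖Jq‖) := by positivity
  linarith

/-! ### Square integrability of jumps and fluxes, positivity of the mesh size -/

namespace SplitDomain

variable {D : SplitDomain}

theorem isOpen_bulk (D : SplitDomain) : IsOpen D.bulk := (D.sub_open 0).union (D.sub_open 1)

theorem sub_subset_bulk (D : SplitDomain) (i : Fin 2) : D.sub i ⊆ D.bulk := by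
  fin_cases i
  · exact subset_union_left
  · exact subset_union_right

/-- Disjoint open sets do not meet each other's closures, so the interface misses both subdomains.
-/
theorem ΓI_subset_frontier (D : SplitDomain) (i : Fin 2) : D.ΓI ⊆ frontier (D.sub i) := by
  rintro x ⟨h0, h1⟩
  rw [(D.sub_open i).frontier_eq]
  have d0 := D.sub_disjoint.closure_left (D.sub_open 1)
  have d1 := D.sub_disjoint.closure_right (D.sub_open 0)
  fin_cases i
  · exact ⟨h0, fun hx => disjoint_left.1 d1 hx h1⟩
  · exact ⟨h1, fun hx => disjoint_left.1 d0 h0 hx⟩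

theorem memLp_jump (D : SplitDomain) (p : E → ℂ) : MemLp (D.jump p) 2 (surf.restrict D.ΓI) :=
  have h := fun i => (memLp_trace (D.sub i) p).mono_measure
    (Measure.restrict_mono (D.ΓI_subset_frontier i) le_rfl)
  (h 0).sub (h 1)

namespace Mesh

theorem memLp_gradTrace (T : D.Mesh) (i : Fin 2) (j : Fin 3) (p : E → ℂ) :
    MemLp (T.gradTrace i j p) 2 (surf.restrict D.ΓI) := by
  unfold gradTrace
  split_ifs with h
  · exact h.choose_spec.1
  · exact MemLp.zero

theorem memLp_normalDeriv (T : D.Mesh) (i : Fin 2) (p : E → ℂ) :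
    MemLp (T.normalDeriv i p) 2 (surf.restrict D.ΓI) := by
  refine memLp_finsetSum _ fun j _ => ?_
  have hg := T.memLp_gradTrace i j p
  have hn : AEStronglyMeasurable (fun x => ((D.normal x j : ℝ) : ℂ)) (surf.restrict D.ΓI) :=
    Continuous.comp_aestronglyMeasurable (g := fun y : E => ((y j : ℝ) : ℂ)) (by fun_prop)
      D.normal_measurable
  refine hg.of_le (hn.mul hg.1) ?_
  have hspec : ∀ᵐ x ∂(surf.restrict D.ΓI), IsOuterNormal (D.sub 0) x (D.normal x) :=
    D.normal_spec
  filter_upwards [hspec] with x hx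
  rw [norm_mul, Complex.norm_real]
  have h1 : ‖D.normal x j‖ ≤ 1 := (PiLp.norm_apply_le (D.normal x) j).trans_eq hx.1
  exact mul_le_of_le_one_left (norm_nonneg _) h1

theorem memLp_avgFlux (T : D.Mesh) (p : E → ℂ) :
    MemLp (T.avgFlux p) 2 (surf.restrict D.ΓI) :=
  ((T.memLp_normalDeriv 0 p).add (T.memLp_normalDeriv 1 p)).const_mul (1 / 2 : ℂ)

theorem MemVhOrH2.memSobolev {T : D.Mesh} {k : ℕ} {p : E → ℂ} (h : T.MemVhOrH2 k p) :
    MemSobolev D.bulk 1 p := by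
  rcases h with ⟨v₁, v₂, h₁, h₂, rfl⟩ | h
  · exact h₁.1.add h₂.1
  · exact h.of_succ

theorem h_pos (T : D.Mesh) : 0 < T.h := by
  -- Without boundedness the real supremum would default to 0.
  have hfin : {d : ℝ | ∃ i, ∃ K ∈ (T.tri i).cells, d = Metric.diam K}.Finite := by
    refine ((Set.finite_iUnion fun i => (T.tri i).finite.image
      fun s : Finset E => Metric.diam (convexHull ℝ (s : Set E)))).subset ?_
    rintro d ⟨i, K, ⟨s, hs, -, rfl⟩, rfl⟩
    exact mem_iUnion.2 ⟨i, s, hs, rfl⟩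
  obtain ⟨x, hx⟩ := (D.sub_connected 0).nonempty
  have hx' : x ∈ (T.tri 0).complex.space := by
    rw [(T.tri 0).cover]; exact subset_closure hx
  obtain ⟨s, hs, -⟩ := Geometry.SimplicialComplex.mem_space_iff.1 hx'
  obtain ⟨t, ht, -, hcard⟩ := (T.tri 0).pure s hs
  have hd : 0 < Metric.diam (convexHull ℝ (t : Set E)) := by
    obtain ⟨a, ha, b, hb, hab⟩ := Finset.one_lt_card.1 (by omega : 1 < t.card)
    rw [convexHull_diam]
    exact (dist_pos.2 hab).trans_le
      (Metric.dist_le_diam_of_mem t.finite_toSet.isBounded ha hb)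
  exact hd.trans_le (le_csSup hfin.bddAbove ⟨0, _, ⟨t, ht, hcard, rfl⟩, rfl⟩)

end Mesh

/-! ### Bounding `a₀` by the triple norm -/

section Bounds

variable (D) (T : D.Mesh) (κ γ : ℝ) (lam : E → ℂ) (p : E → ℂ)

theorem tripleNorm_sq (hγ : 0 < γ) : D.tripleNorm T κ γ lam p ^ 2 =
    (∫ x in D.bulk, ∑ j : Fin 3, ‖weakPartial D.bulk j p x‖ ^ 2)
    + κ ^ 2 * (∫ x in D.bulk, ‖p x‖ ^ 2)
    + 1 / γ * (∫ x in D.ΓI, T.h * ‖T.avgFlux p x‖ ^ 2 ∂surf)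
    + (∫ x in D.ΓI, ‖lam x‖ * ‖D.jump p x‖ ^ 2 ∂surf) := by
  have hh := T.h_pos
  refine Real.sq_sqrt ?_
  refine add_nonneg (add_nonneg (add_nonneg (integral_nonneg fun x => by positivity)
    (mul_nonneg (by positivity) (integral_nonneg fun x => by positivity)))
    (mul_nonneg (by positivity) (integral_nonneg fun x => by positivity)))
    (integral_nonneg fun x => by positivity)

theorem bulk_interface_le_tripleNorm_sq (hγ : 0 < γ) :
    (∫ x in D.bulk, ∑ j : Fin 3, ‖weakPartial D.bulk j p x‖ ^ 2) ≤
      D.tripleNorm T κ γ lam p ^ 2 ∧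
    κ ^ 2 * (∫ x in D.bulk, ‖p x‖ ^ 2) ≤ D.tripleNorm T κ γ lam p ^ 2 ∧
    1 / γ * (∫ x in D.ΓI, T.h * ‖T.avgFlux p x‖ ^ 2 ∂surf) +
      (∫ x in D.ΓI, ‖lam x‖ * ‖D.jump p x‖ ^ 2 ∂surf) ≤ D.tripleNorm T κ γ lam p ^ 2 := by
  have hh := T.h_pos
  rw [D.tripleNorm_sq T κ γ lam p hγ]
  have a1 : 0 ≤ ∫ x in D.bulk, ∑ j : Fin 3, ‖weakPartial D.bulk j p x‖ ^ 2 :=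
    integral_nonneg fun x => by positivity
  have a2 : 0 ≤ κ ^ 2 * (∫ x in D.bulk, ‖p x‖ ^ 2) :=
    mul_nonneg (by positivity) (integral_nonneg fun x => by positivity)
  have a3 : 0 ≤ 1 / γ * (∫ x in D.ΓI, T.h * ‖T.avgFlux p x‖ ^ 2 ∂surf) :=
    mul_nonneg (by positivity) (integral_nonneg fun x => by positivity)
  have a4 : 0 ≤ ∫ x in D.ΓI, ‖lam x‖ * ‖D.jump p x‖ ^ 2 ∂surf :=
    integral_nonneg fun x => by positivity
  refine ⟨?_, ?_, ?_⟩ <;> linarith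

theorem tripleNorm_nonneg : 0 ≤ D.tripleNorm T κ γ lam p := Real.sqrt_nonneg _

theorem sum_integral_weakPartial :
    ∑ j : Fin 3, ∫ x in D.bulk, ‖weakPartial D.bulk j p x‖ ^ 2 =
      ∫ x in D.bulk, ∑ j : Fin 3, ‖weakPartial D.bulk j p x‖ ^ 2 :=
  (integral_finsetSum _ fun j _ =>
    (memLp_weakPartial D.bulk j p).integrable_norm_pow (p := 2) two_ne_zero).symm

theorem sqrt_integral_weakPartial_le (hγ : 0 < γ) (j : Fin 3) :
    √(∫ x in D.bulk, ‖weakPartial D.bulk j p x‖ ^ 2) ≤ D.tripleNorm T κ γ lam p := by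
  refine Real.sqrt_le_iff.2 ⟨D.tripleNorm_nonneg T κ γ lam p, ?_⟩
  refine le_trans ?_ (D.bulk_interface_le_tripleNorm_sq T κ γ lam p hγ).1
  rw [← D.sum_integral_weakPartial p]
  exact Finset.single_le_sum
    (f := fun j => ∫ x in D.bulk, ‖weakPartial D.bulk j p x‖ ^ 2)
    (fun j _ => integral_nonneg fun x => by positivity) (Finset.mem_univ j)

theorem mul_sqrt_integral_le (hκ : 0 < κ) (hγ : 0 < γ) :
    κ * √(∫ x in D.bulk, ‖p x‖ ^ 2) ≤ D.tripleNorm T κ γ lam p := by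
  have h := (D.bulk_interface_le_tripleNorm_sq T κ γ lam p hγ).2.1
  calc κ * √(∫ x in D.bulk, ‖p x‖ ^ 2) = √(κ ^ 2 * ∫ x in D.bulk, ‖p x‖ ^ 2) := by
        rw [Real.sqrt_mul (by positivity), Real.sqrt_sq hκ.le]
    _ ≤ _ := Real.sqrt_le_iff.2 ⟨D.tripleNorm_nonneg T κ γ lam p, h⟩

/-- The norm controls κ²‖p‖² only, hence the loss 1/κ². -/
theorem sobolevNormSq_bulk_le (hκ : 0 < κ) (hγ : 0 < γ) :
    sobolevNormSq D.bulk p ≤ (1 + 1 / κ ^ 2) * D.tripleNorm T κ γ lam p ^ 2 := by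
  obtain ⟨h1, h2, -⟩ := D.bulk_interface_le_tripleNorm_sq T κ γ lam p hγ
  rw [sobolevNormSq, D.sum_integral_weakPartial p]
  have h3 : ∫ x in D.bulk, ‖p x‖ ^ 2 ≤ 1 / κ ^ 2 * D.tripleNorm T κ γ lam p ^ 2 := by
    rw [one_div, ← div_eq_inv_mul, le_div_iff₀ (by positivity), mul_comm]
    exact h2
  linarith

theorem sqrt_integral_trace_le {p : E → ℂ} (hp : MemSobolev D.bulk 1 p) (hκ : 0 < κ)
    (hγ : 0 < γ) {c : ℝ} (hc : D.IsTraceConstant c) (i : Fin 2) :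
    √(∫ x in D.Γio ∩ frontier (D.sub i), ‖trace (D.sub i) p x‖ ^ 2 ∂surf) ≤
      c * √(1 + 1 / κ ^ 2) * D.tripleNorm T κ γ lam p := by
  have hN := D.tripleNorm_nonneg T κ γ lam p
  have hc0 := hc.1
  refine Real.sqrt_le_iff.2 ⟨by positivity, ?_⟩
  calc _ ≤ ∫ x in frontier (D.sub i), ‖trace (D.sub i) p x‖ ^ 2 ∂surf :=
        setIntegral_norm_sq_mono inter_subset_right (memLp_trace _ _)
    _ ≤ c ^ 2 * sobolevNormSq (D.sub i) p :=
        hc.2 i p (hp.mono D.isOpen_bulk (D.sub_subset_bulk i))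
    _ ≤ c ^ 2 * ((1 + 1 / κ ^ 2) * D.tripleNorm T κ γ lam p ^ 2) := by
        gcongr
        exact (hp.sobolevNormSq_le D.isOpen_bulk (D.sub_open i) (D.sub_subset_bulk i)).trans
          (D.sobolevNormSq_bulk_le T κ γ lam p hκ hγ)
    _ = _ := by
        rw [mul_pow, mul_pow, Real.sq_sqrt (by positivity), mul_assoc]

/-- The 4 counts three partial derivatives and the mass term, each by Cauchy-Schwarz; the rest is
the trace bound on Γ_io, once for each of the two subdomains. -/
theorem norm_a₀_le {p q : E → ℂ} (hp : MemSobolev D.bulk 1 p) (hq : MemSobolev D.bulk 1 q)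
    (hκ : 0 < κ) (hγ : 0 < γ) {c : ℝ} (hc : D.IsTraceConstant c) :
    ‖D.a₀ κ p q‖ ≤ (4 + 2 * κ * c ^ 2 * (1 + 1 / κ ^ 2)) *
      (D.tripleNorm T κ γ lam p * D.tripleNorm T κ γ lam q) := by
  set N := D.tripleNorm T κ γ lam p with hN
  set N' := D.tripleNorm T κ γ lam q with hN'
  have hN0 : 0 ≤ N := D.tripleNorm_nonneg T κ γ lam p
  have hN'0 : 0 ≤ N' := D.tripleNorm_nonneg T κ γ lam q
  have hc0 := hc.1
  have hgrad : ‖∫ x in D.bulk, ∑ j : Fin 3,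
      weakPartial D.bulk j p x * weakPartial D.bulk j q x‖ ≤ 3 * (N * N') := by
    rw [integral_finsetSum _ fun j _ => by exact
      (memLp_weakPartial D.bulk j p).integrable_mul (memLp_weakPartial D.bulk j q)]
    calc _ ≤ ∑ _j : Fin 3, N * N' := by
          refine (norm_sum_le _ _).trans (Finset.sum_le_sum fun j _ => ?_)
          refine (norm_integral_mul_le (memLp_weakPartial D.bulk j p)
            (memLp_weakPartial D.bulk j q)).trans ?_
          exact mul_le_mul (D.sqrt_integral_weakPartial_le T κ γ lam p hγ j)
            (D.sqrt_integral_weakPartial_le T κ γ lam q hγ j) (Real.sqrt_nonneg _) hN0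
      _ = _ := by simp
  have hmass : ‖(κ : ℂ) ^ 2 * ∫ x in D.bulk, p x * q x‖ ≤ N * N' := by
    rw [norm_mul, norm_pow, Complex.norm_real, Real.norm_of_nonneg hκ.le]
    calc _ ≤ κ ^ 2 * (√(∫ x in D.bulk, ‖p x‖ ^ 2) * √(∫ x in D.bulk, ‖q x‖ ^ 2)) := by
          gcongr
          exact norm_integral_mul_le hp.memLp hq.memLp
      _ = (κ * √(∫ x in D.bulk, ‖p x‖ ^ 2)) * (κ * √(∫ x in D.bulk, ‖q x‖ ^ 2)) := by ring
      _ ≤ _ := mul_le_mul (D.mul_sqrt_integral_le T κ γ lam p hκ hγ)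
            (D.mul_sqrt_integral_le T κ γ lam q hκ hγ) (by positivity) hN0
  have hbdry : ‖Complex.I * (κ : ℂ) * ∑ i : Fin 2, ∫ x in D.Γio ∩ frontier (D.sub i),
        trace (D.sub i) p x * trace (D.sub i) q x ∂surf‖ ≤
      2 * κ * c ^ 2 * (1 + 1 / κ ^ 2) * (N * N') := by
    rw [norm_mul, norm_mul, Complex.norm_I, one_mul, Complex.norm_real,
      Real.norm_of_nonneg hκ.le]
    have hL : ∀ (i : Fin 2) (p : E → ℂ), MemLp (trace (D.sub i) p) 2
        (surf.restrict (D.Γio ∩ frontier (D.sub i))) := fun i p =>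
      (memLp_trace _ p).mono_measure (Measure.restrict_mono inter_subset_right le_rfl)
    calc _ ≤ κ * ∑ _i : Fin 2, (c * √(1 + 1 / κ ^ 2) * N) * (c * √(1 + 1 / κ ^ 2) * N') := by
          gcongr
          refine (norm_sum_le _ _).trans (Finset.sum_le_sum fun i _ => ?_)
          refine (norm_integral_mul_le (hL i p) (hL i q)).trans ?_
          exact mul_le_mul (D.sqrt_integral_trace_le T κ γ lam hp hκ hγ hc i)
            (D.sqrt_integral_trace_le T κ γ lam hq hκ hγ hc i) (Real.sqrt_nonneg _)
            (by positivity)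
      _ = 2 * κ * c ^ 2 * (√(1 + 1 / κ ^ 2) * √(1 + 1 / κ ^ 2)) * (N * N') := by
          simp only [Finset.sum_const, Finset.card_univ, Fintype.card_fin, nsmul_eq_mul]
          push_cast
          ring
      _ = _ := by rw [Real.mul_self_sqrt (by positivity)]
  unfold a₀
  calc _ ≤ 3 * (N * N') + N * N' + 2 * κ * c ^ 2 * (1 + 1 / κ ^ 2) * (N * N') :=
        (norm_add_le _ _).trans (add_le_add ((norm_sub_le _ _).trans
          (add_le_add hgrad hmass)) hbdry)
    _ = _ := by ring

end Bounds

/-! ### Bounding the interface terms -/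

section Interface

variable (D) (T : D.Mesh) {κ γ : ℝ} {ζ : E → ℂ}

/-- The weighted sum of flux and jump that dominates the interface terms. -/
noncomputable def interfaceWeight (γ : ℝ) (lam p : E → ℂ) (x : E) : ℝ :=
  √2 * (√(T.h / γ) * ‖T.avgFlux p x‖ + √‖lam x‖ * ‖D.jump p x‖)

/-- Gives λ ∈ L^∞, which makes the interface integrals converge; the h-dependent bound does not
enter the final constant. -/
theorem ae_norm_lamFun_le (hκ : 0 < κ) (hγ : 0 < γ)
    (hζ : ∀ᵐ x ∂(surf.restrict D.ΓI), T.h * (ζ x).im ≥ -(γ / (4 * κ)) * ‖ζ x‖ ^ 2) :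
    ∀ᵐ x ∂(surf.restrict D.ΓI), ‖lamFun κ γ T.h ζ x‖ ≤ γ / T.h := by
  have hh := T.h_pos
  filter_upwards [hζ] with x hx
  have h1 := (lam_bounds hκ hγ hh hx).2.1
  rw [← le_div_iff₀ (by positivity), one_div_div] at h1
  exact h1

theorem memLp_lamFun (hκ : 0 < κ) (hγ : 0 < γ) (hζL : MemLp ζ ⊤ (surf.restrict D.ΓI))
    (hζ : ∀ᵐ x ∂(surf.restrict D.ΓI), T.h * (ζ x).im ≥ -(γ / (4 * κ)) * ‖ζ x‖ ^ 2) :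
    MemLp (lamFun κ γ T.h ζ) ⊤ (surf.restrict D.ΓI) := by
  refine memLp_top_of_bound ?_ _ (D.ae_norm_lamFun_le T hκ hγ hζ)
  have h1 : AEMeasurable ζ (surf.restrict D.ΓI) := hζL.1.aemeasurable
  exact ((h1.div_const _).const_add _).inv.aestronglyMeasurable

theorem memLp_sqrt_lamFun_mul_jump (hκ : 0 < κ) (hγ : 0 < γ)
    (hζL : MemLp ζ ⊤ (surf.restrict D.ΓI))
    (hζ : ∀ᵐ x ∂(surf.restrict D.ΓI), T.h * (ζ x).im ≥ -(γ / (4 * κ)) * ‖ζ x‖ ^ 2)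
    (p : E → ℂ) :
    MemLp (fun x => √‖lamFun κ γ T.h ζ x‖ * ‖D.jump p x‖) 2 (surf.restrict D.ΓI) := by
  have h1 : MemLp (fun x => √‖lamFun κ γ T.h ζ x‖) ⊤ (surf.restrict D.ΓI) := by
    refine memLp_top_of_bound ?_ (√(γ / T.h)) ?_
    · exact Real.continuous_sqrt.comp_aestronglyMeasurable
        (D.memLp_lamFun T hκ hγ hζL hζ).1.norm
    · filter_upwards [D.ae_norm_lamFun_le T hκ hγ hζ] with x hx
      rw [Real.norm_of_nonneg (Real.sqrt_nonneg _)]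
      exact Real.sqrt_le_sqrt hx
  exact (D.memLp_jump p).norm.mul h1 (r := 2)

theorem memLp_interfaceWeight (hκ : 0 < κ) (hγ : 0 < γ)
    (hζL : MemLp ζ ⊤ (surf.restrict D.ΓI))
    (hζ : ∀ᵐ x ∂(surf.restrict D.ΓI), T.h * (ζ x).im ≥ -(γ / (4 * κ)) * ‖ζ x‖ ^ 2)
    (p : E → ℂ) :
    MemLp (D.interfaceWeight T γ (lamFun κ γ T.h ζ) p) 2 (surf.restrict D.ΓI) :=
  (((T.memLp_avgFlux p).norm.const_mul _).add
    (D.memLp_sqrt_lamFun_mul_jump T hκ hγ hζL hζ p)).const_mul _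

/-- The 2 comes from (√2 (a + b))² ≤ 4 (a² + b²), where the integrals of a² and b² are the flux and
jump parts of the squared norm. -/
theorem sqrt_integral_interfaceWeight_le (hκ : 0 < κ) (hγ : 0 < γ)
    (hζL : MemLp ζ ⊤ (surf.restrict D.ΓI))
    (hζ : ∀ᵐ x ∂(surf.restrict D.ΓI), T.h * (ζ x).im ≥ -(γ / (4 * κ)) * ‖ζ x‖ ^ 2)
    (p : E → ℂ) :
    √(∫ x in D.ΓI, D.interfaceWeight T γ (lamFun κ γ T.h ζ) p x ^ 2 ∂surf) ≤
      2 * D.tripleNorm T κ γ (lamFun κ γ T.h ζ) p := by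
  have hh := T.h_pos
  have hN := D.tripleNorm_nonneg T κ γ (lamFun κ γ T.h ζ) p
  refine Real.sqrt_le_iff.2 ⟨by positivity, ?_⟩
  have hA := ((T.memLp_avgFlux p).norm.const_mul (√(T.h / γ))).integrable_sq
  have hB := (D.memLp_sqrt_lamFun_mul_jump T hκ hγ hζL hζ p).integrable_sq
  have eA : ∫ x in D.ΓI, (√(T.h / γ) * ‖T.avgFlux p x‖) ^ 2 ∂surf =
      1 / γ * (∫ x in D.ΓI, T.h * ‖T.avgFlux p x‖ ^ 2 ∂surf) := by
    rw [← integral_const_mul]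
    refine integral_congr_ae (ae_of_all _ fun x => ?_)
    simp only
    rw [mul_pow, Real.sq_sqrt (by positivity)]
    ring
  have eB : ∫ x in D.ΓI, (√‖lamFun κ γ T.h ζ x‖ * ‖D.jump p x‖) ^ 2 ∂surf =
      ∫ x in D.ΓI, ‖lamFun κ γ T.h ζ x‖ * ‖D.jump p x‖ ^ 2 ∂surf := by
    refine integral_congr_ae (ae_of_all _ fun x => ?_)
    simp only
    rw [mul_pow, Real.sq_sqrt (norm_nonneg _)]
  calc _ ≤ ∫ x in D.ΓI, 4 * ((√(T.h / γ) * ‖T.avgFlux p x‖) ^ 2 +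
          (√‖lamFun κ γ T.h ζ x‖ * ‖D.jump p x‖) ^ 2) ∂surf := by
        refine integral_mono (D.memLp_interfaceWeight T hκ hγ hζL hζ p).integrable_sq
          ((hA.add hB).const_mul 4) fun x => ?_
        simp only [interfaceWeight]
        rw [mul_pow, Real.sq_sqrt (by norm_num : (0 : ℝ) ≤ 2)]
        nlinarith [sq_nonneg (√(T.h / γ) * ‖T.avgFlux p x‖ -
          √‖lamFun κ γ T.h ζ x‖ * ‖D.jump p x‖)]
    _ = 4 * (1 / γ * (∫ x in D.ΓI, T.h * ‖T.avgFlux p x‖ ^ 2 ∂surf) +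
          ∫ x in D.ΓI, ‖lamFun κ γ T.h ζ x‖ * ‖D.jump p x‖ ^ 2 ∂surf) := by
        rw [integral_const_mul, integral_add hA hB, eA, eB]
    _ ≤ 4 * D.tripleNorm T κ γ (lamFun κ γ T.h ζ) p ^ 2 := by
        gcongr
        exact (D.bulk_interface_le_tripleNorm_sq T κ γ (lamFun κ γ T.h ζ) p hγ).2.2
    _ = _ := by ring

theorem norm_aLam_sub_a₀_le (hκ : 0 < κ) (hγ : 0 < γ)
    (hζL : MemLp ζ ⊤ (surf.restrict D.ΓI))
    (hζ : ∀ᵐ x ∂(surf.restrict D.ΓI), T.h * (ζ x).im ≥ -(γ / (4 * κ)) * ‖ζ x‖ ^ 2)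
    (p q : E → ℂ) :
    ‖D.aLam T κ ζ (lamFun κ γ T.h ζ) p q - D.a₀ κ p q‖ ≤
      4 * (D.tripleNorm T κ γ (lamFun κ γ T.h ζ) p *
        D.tripleNorm T κ γ (lamFun κ γ T.h ζ) q) := by
  have hh := T.h_pos
  have hN := D.tripleNorm_nonneg T κ γ (lamFun κ γ T.h ζ) p
  have hz : MemLp (fun x => ζ x / (Complex.I * κ)) ⊤ (surf.restrict D.ΓI) := by
    simpa only [div_eq_mul_inv] using hζL.mul_const _
  have hP := fun p => T.memLp_avgFlux p
  have hJ := fun p => D.memLp_jump p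
  have hzP : ∀ p, MemLp (fun x => ζ x / (Complex.I * κ) * T.avgFlux p x) 2
      (surf.restrict D.ΓI) := fun p => (hP p).mul hz (r := 2)
  have hR : ∀ p, MemLp (fun x => D.jump p x + ζ x / (Complex.I * κ) * T.avgFlux p x) 2
      (surf.restrict D.ΓI) := fun p => (hJ p).add (hzP p)
  have hlR : MemLp (fun x => lamFun κ γ T.h ζ x *
      (D.jump p x + ζ x / (Complex.I * κ) * T.avgFlux p x)) 2 (surf.restrict D.ΓI) :=
    (hR p).mul (D.memLp_lamFun T hκ hγ hζL hζ) (r := 2)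
  -- The cancellation is pointwise, so the four integrals must be merged into one first, which
  -- requires each integrand to be integrable.
  have i1 : Integrable (fun x => T.avgFlux p x *
      (D.jump q x + ζ x / (Complex.I * κ) * T.avgFlux q x)) (surf.restrict D.ΓI) :=
    (hP p).integrable_mul (hR q)
  have i2 : Integrable (fun x => (D.jump p x + ζ x / (Complex.I * κ) * T.avgFlux p x) *
      T.avgFlux q x) (surf.restrict D.ΓI) := (hR p).integrable_mul (hP q)
  have i3 : Integrable (fun x => ζ x / (Complex.I * κ) * T.avgFlux p x * T.avgFlux q x)
      (surf.restrict D.ΓI) := (hzP p).integrable_mul (hP q)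
  have i4 : Integrable (fun x => lamFun κ γ T.h ζ x *
      (D.jump p x + ζ x / (Complex.I * κ) * T.avgFlux p x) *
      (D.jump q x + ζ x / (Complex.I * κ) * T.avgFlux q x)) (surf.restrict D.ΓI) :=
    hlR.integrable_mul (hR q)
  have hsum : D.aLam T κ ζ (lamFun κ γ T.h ζ) p q - D.a₀ κ p q =
      ∫ x in D.ΓI, (-(T.avgFlux p x * (D.jump q x + ζ x / (Complex.I * κ) * T.avgFlux q x))
        - (D.jump p x + ζ x / (Complex.I * κ) * T.avgFlux p x) * T.avgFlux q x
        + ζ x / (Complex.I * κ) * T.avgFlux p x * T.avgFlux q x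
        + lamFun κ γ T.h ζ x * (D.jump p x + ζ x / (Complex.I * κ) * T.avgFlux p x) *
          (D.jump q x + ζ x / (Complex.I * κ) * T.avgFlux q x)) ∂surf := by
    rw [integral_add (by exact (i1.neg.sub i2).add i3) i4,
      integral_add (by exact i1.neg.sub i2) i3, integral_sub (by exact i1.neg) i2, integral_neg]
    unfold aLam
    ring
  rw [hsum]
  refine (norm_integral_le_sqrt_mul_sqrt (D.memLp_interfaceWeight T hκ hγ hζL hζ p)
    (D.memLp_interfaceWeight T hκ hγ hζL hζ q) (fun x => ?_) (fun x => ?_) ?_).trans ?_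
  · unfold interfaceWeight; positivity
  · unfold interfaceWeight; positivity
  · filter_upwards [hζ] with x hx
    obtain ⟨h0, h1, h2⟩ := lam_bounds hκ hγ hh hx
    exact norm_interface_le (div_pos hh hγ) h0 rfl h1 h2
  · calc _ ≤ (2 * D.tripleNorm T κ γ (lamFun κ γ T.h ζ) p) *
          (2 * D.tripleNorm T κ γ (lamFun κ γ T.h ζ) q) :=
        mul_le_mul (D.sqrt_integral_interfaceWeight_le T hκ hγ hζL hζ p)
          (D.sqrt_integral_interfaceWeight_le T hκ hγ hζL hζ q) (Real.sqrt_nonneg _)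
          (by positivity)
      _ = _ := by ring

end Interface

end SplitDomain

end NitscheHelmholtz

theorem theorem1 :
    ∃ Cc : ℝ → ℝ → ℝ, ∀ D : NitscheHelmholtz.SplitDomain, Nonempty D.Mesh →
      (∃ c : ℝ, D.IsTraceConstant c) ∧
      ∀ c : ℝ, D.IsTraceConstant c → ∀ κ : ℝ, 0 < κ →
        ∀ (T : D.Mesh) (k : ℕ) (γ : ℝ) (ζ : NitscheHelmholtz.E → ℂ), 1 ≤ k → 0 < γ →
          MemLp ζ ∞ (NitscheHelmholtz.surf.restrict D.ΓI) →
          (∀ᵐ x ∂(NitscheHelmholtz.surf.restrict D.ΓI),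
            T.h * (ζ x).im ≥ -(γ / (4 * κ)) * ‖ζ x‖ ^ 2) →
          ∀ p q : NitscheHelmholtz.E → ℂ, T.MemVhOrH2 k p → T.MemVhOrH2 k q →
            ‖D.aLam T κ ζ (NitscheHelmholtz.lamFun κ γ T.h ζ) p q‖ ≤
              Cc κ c * D.tripleNorm T κ γ (NitscheHelmholtz.lamFun κ γ T.h ζ) p *
                D.tripleNorm T κ γ (NitscheHelmholtz.lamFun κ γ T.h ζ) q := by
  -- 8 = 4 + 4: the bulk part of `a₀` and the interface terms.
  refine ⟨fun κ c => 8 + 2 * κ * c ^ 2 * (1 + 1 / κ ^ 2), fun D hD =>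
    ⟨hD.some.exists_isTraceConstant, ?_⟩⟩
  intro c hc κ hκ T k γ ζ _ hγ hζL hζ p q hp hq
  have h1 := D.norm_a₀_le T κ γ (NitscheHelmholtz.lamFun κ γ T.h ζ) hp.memSobolev hq.memSobolev
    hκ hγ hc
  have h2 := D.norm_aLam_sub_a₀_le T hκ hγ hζL hζ p q
  have h3 := norm_le_norm_add_norm_sub' (D.aLam T κ ζ (NitscheHelmholtz.lamFun κ γ T.h ζ) p q)
    (D.a₀ κ p q)
  refine (h3.trans (add_le_add h1 h2)).trans_eq ?_
  ring
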